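/- Let $N\ge 1$ be an integer and $K>0$, $\lambda>0$ real. Consider one of the following four choices of a classical domain $R$, a function $h>0$ on $R$, and a number $g$ (with $m,n,p,q\ge 1$): (I) $R_I(m,n)$, the complex $m\times n$ matrices $Z$ with $I-Z\overline Z^t>0$; $h(Z)=\det(I-Z\overline Z^t)$, $g=m+n$; (II) $R_{II}(p)$, the symmetric complex $p\times p$ matrices $Z$ with $I-Z\overline Z^t>0$; $h(Z)=\det(I-Z\overline Z^t)$, $g=p+1$; (III) $R_{III}(q)$, the skew-symmetric complex $q\times q$ matrices $Z$ with $I-Z\overline Z^t>0$; $h(Z)=\det(I-Z\overline Z^t)$, $g=q-1$; (IV) $R_{IV}(n)$, the row vectors $Z\in\mathbb C^n$ with $1+|ZZ^t|^2-2Z\overline Z^t>0$ and $1-|ZZ^t|^2>0$; $h(Z)=1+|ZZ^t|^2-2Z\overline Z^t$, $g=n$. Take as coordinates of $Z$ all entries in cases (I) and (IV), the entries $z_{ij}$ with $i\le j$ in case (II), and those with $i<j$ in case (III). Let $$Y_R=\{(Z,W): Z\in R,\ W\in\mathbb C^N,\ |W|^{2K}<h(Z)\}$$ be the Cartan–Hartogs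 domain, let $z=(z_1,\dots,z_d)$ be the coordinates of $(Z,W)$, and put $$X=|W|^2h(Z)^{-1/K},\qquad Y=(1-X)^{-1},\qquad G_\lambda=Y^{\lambda}\,h(Z)^{-(g+N/K)},\qquad T_\lambda=\left(\frac{\partial^2\log G_\lambda}{\partial z_i\,\partial\overline z_j}\right).$$ Theorem. On $Y_R$ the function $G_\lambda$ is positive, $\log G_\lambda$ is smooth and $T_\lambda$ is positive definite, so that $T_\lambda$ defines a metric $\omega_{G_\lambda}(Y_R)$. Its Ricci curvature is bounded from above and below by negative constants: there are constants $a,b>0$ (depending on the domain $Y_R$ and on $\lambda$) such that for all $(Z,W)\in Y_R$ and all $v\in\mathbb C^d\setminus\{0\}$ $$-a\ \le\ \mathrm{Ric}_\lambda(Z,W;v):=-\,\frac{\sum_{i,j}\frac{\partial^2\log\det T_\lambda}{\partial z_i\,\partial\overline z_j}\,v_i\overline v_j}{\sum_{i,j}(T_\lambda)_{ij}\,v_i\overline v_j}\ \le\ -b .$$ -/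

import Mathlib

open scoped ContDiff ComplexOrder

noncomputable section

namespace CartanHartogs

/-! ### Hermitian metrics with a potential, and their Ricci curvature, in coordinates -/

section Kahler

variable {κ : Type*} [Fintype κ] [DecidableEq κ]

/-- `∂f/∂z_i` at `z`. -/
def dz (i : κ) (f : (κ → ℂ) → ℂ) (z : κ → ℂ) : ℂ :=
  (fderiv ℝ f z (Pi.single i 1) - Complex.I * fderiv ℝ f z (Pi.single i Complex.I)) / 2

/-- `∂f/∂z̄_i` at `z`. -/
def dzbar (i : κ) (f : (κ → ℂ) → ℂ) (z : κ → ℂ) : ℂ :=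
  (fderiv ℝ f z (Pi.single i 1) + Complex.I * fderiv ℝ f z (Pi.single i Complex.I)) / 2

/-- The matrix `(∂²f / ∂z_i ∂z̄_j)` of a real-valued function `f`. -/
def complexHessian (f : (κ → ℂ) → ℝ) (z : κ → ℂ) : Matrix κ κ ℂ :=
  Matrix.of fun i j => dz i (dzbar j fun w => (f w : ℂ)) z

/-- `∑ v_i T_{ij} v̄_j`, a real number when `T` is Hermitian. -/
def hermForm (T : Matrix κ κ ℂ) (v : κ → ℂ) : ℝ :=
  (∑ i, ∑ j, v i * T i j * star (v j)).re

/-- The metric matrix `(∂² log G / ∂z_i ∂z̄_j)` generated by a positive function `G`. -/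
def metricMatrix (G : (κ → ℂ) → ℝ) (z : κ → ℂ) : Matrix κ κ ℂ :=
  complexHessian (fun w => Real.log (G w)) z

/-- The Ricci curvature, at `z` in the direction `v`, of the metric with matrix `T`:
`- (∑ (∂² log det T / ∂z_i ∂z̄_j) v_i v̄_j) / (∑ T_{ij} v_i v̄_j)`. -/
def ricciCurvature (T : (κ → ℂ) → Matrix κ κ ℂ) (z v : κ → ℂ) : ℝ :=
  -(hermForm (complexHessian (fun w => Real.log (T w).det.re) z) v / hermForm (T z) v)

/-- On `Ω`, the function `log G` is smooth, the matrix `(∂² log G / ∂z_i ∂z̄_j)` is positive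
definite (so that it is a Kähler metric), and the Ricci curvature of this metric lies between two
negative constants, uniformly in the point and in the direction. -/
def RicciPinched (Ω : Set (κ → ℂ)) (G : (κ → ℂ) → ℝ) : Prop :=
  (∀ z ∈ Ω, 0 < G z ∧ ContDiffAt ℝ ∞ (fun w => Real.log (G w)) z ∧ (metricMatrix G z).PosDef) ∧
  ∃ a b : ℝ, 0 < a ∧ 0 < b ∧ ∀ z ∈ Ω, ∀ v : κ → ℂ, v ≠ 0 →
    -a ≤ ricciCurvature (metricMatrix G) z v ∧ ricciCurvature (metricMatrix G) z v ≤ -b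

end Kahler

/-! ### Hartogs domains over a base `R` in `ℂ^ι`, with a positive function `h` on `R` -/

section Hartogs

variable {ι : Type*} {N : ℕ}

/-- The base component `Z` of a point `(Z, W)`. -/
def basePart (z : ι ⊕ Fin N → ℂ) : ι → ℂ := fun i => z (Sum.inl i)

/-- `|W|²`, the squared Euclidean norm of the fibre component `W` of a point `(Z, W)`. -/
def fibreSq (z : ι ⊕ Fin N → ℂ) : ℝ := ∑ k, ‖z (Sum.inr k)‖ ^ 2

/-- `{(Z, W) : Z ∈ R, |W|^{2K} < h(Z)}`. -/
def hartogsDomain (R : Set (ι → ℂ)) (h : (ι → ℂ) → ℝ) (N : ℕ) (K : ℝ) :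
    Set (ι ⊕ Fin N → ℂ) :=
  {z | basePart z ∈ R ∧ fibreSq z ^ K < h (basePart z)}

/-- `X = |W|² h(Z)^{-1/K}`. -/
def fnX (h : (ι → ℂ) → ℝ) (K : ℝ) (z : ι ⊕ Fin N → ℂ) : ℝ :=
  fibreSq z * h (basePart z) ^ (-(1 / K))

/-- `Y = (1 - X)⁻¹`. -/
def fnY (h : (ι → ℂ) → ℝ) (K : ℝ) (z : ι ⊕ Fin N → ℂ) : ℝ := (1 - fnX h K z)⁻¹

/-- `G_λ = Y^λ h(Z)^{-(g + N/K)}`. -/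
def fnG (h : (ι → ℂ) → ℝ) (g K lam : ℝ) (z : ι ⊕ Fin N → ℂ) : ℝ :=
  fnY h K z ^ lam * h (basePart z) ^ (-(g + N / K))

end Hartogs

/-! ### The four classical domains -/

/-- `det (I - Z Z̄ᵗ)`, which is real. -/
def detNorm {m n : ℕ} (Z : Matrix (Fin m) (Fin n) ℂ) : ℝ := (1 - Z * Z.conjTranspose).det.re

/-- Coordinates `z_{ij}` of an `m × n` matrix. -/
abbrev IdxI (m n : ℕ) : Type := Fin m × Fin n

/-- Coordinates `z_{ij}`, `i ≤ j`, of a symmetric matrix. -/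
abbrev IdxII (p : ℕ) : Type := {x : Fin p × Fin p // x.1 ≤ x.2}

/-- Coordinates `z_{ij}`, `i < j`, of a skew-symmetric matrix. -/
abbrev IdxIII (q : ℕ) : Type := {x : Fin q × Fin q // x.1 < x.2}

def matI {m n : ℕ} (z : IdxI m n → ℂ) : Matrix (Fin m) (Fin n) ℂ := Matrix.of fun i j => z (i, j)

/-- The symmetric matrix with the given entries on and above the diagonal. -/
def matII {p : ℕ} (z : IdxII p → ℂ) : Matrix (Fin p) (Fin p) ℂ :=
  Matrix.of fun i j => z ⟨(min i j, max i j), min_le_max⟩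

/-- The skew-symmetric matrix with the given entries above the diagonal. -/
def matIII {q : ℕ} (z : IdxIII q → ℂ) : Matrix (Fin q) (Fin q) ℂ :=
  Matrix.of fun i j =>
    if hij : i < j then z ⟨(i, j), hij⟩ else if hji : j < i then -z ⟨(j, i), hji⟩ else 0

/-- `R_I(m,n)`: `m × n` matrices with `I - Z Z̄ᵗ > 0`. -/
def RI (m n : ℕ) : Set (IdxI m n → ℂ) := {z | (1 - matI z * (matI z).conjTranspose).PosDef}

/-- `R_II(p)`: symmetric `p × p` matrices with `I - Z Z̄ᵗ > 0`. -/
def RII (p : ℕ) : Set (IdxII p → ℂ) := {z | (1 - matII z * (matII z).conjTranspose).PosDef}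

/-- `R_III(q)`: skew-symmetric `q × q` matrices with `I - Z Z̄ᵗ > 0`. -/
def RIII (q : ℕ) : Set (IdxIII q → ℂ) := {z | (1 - matIII z * (matIII z).conjTranspose).PosDef}

/-- `β(Z, Z̄) = 1 + |Z Zᵗ|² - 2 Z Z̄ᵗ`. -/
def beta {n : ℕ} (z : Fin n → ℂ) : ℝ := 1 + ‖∑ i, z i ^ 2‖ ^ 2 - 2 * ∑ i, ‖z i‖ ^ 2

/-- `R_IV(n)`, the Lie ball: `1 + |Z Zᵗ|² - 2 Z Z̄ᵗ > 0` and `1 - |Z Zᵗ|² > 0`. -/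
def RIV (n : ℕ) : Set (Fin n → ℂ) := {z | 0 < beta z ∧ 0 < 1 - ‖∑ i, z i ^ 2‖ ^ 2}

/-! ### The four Cartan–Hartogs domains and the functions `G_λ` on them -/

def YI (m n N : ℕ) (K : ℝ) : Set (IdxI m n ⊕ Fin N → ℂ) :=
  hartogsDomain (RI m n) (fun z => detNorm (matI z)) N K

def GI (m n N : ℕ) (K lam : ℝ) : (IdxI m n ⊕ Fin N → ℂ) → ℝ :=
  fnG (fun z => detNorm (matI z)) (m + n) K lam

def YII (p N : ℕ) (K : ℝ) : Set (IdxII p ⊕ Fin N → ℂ) :=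
  hartogsDomain (RII p) (fun z => detNorm (matII z)) N K

def GII (p N : ℕ) (K lam : ℝ) : (IdxII p ⊕ Fin N → ℂ) → ℝ :=
  fnG (fun z => detNorm (matII z)) (p + 1) K lam

def YIII (q N : ℕ) (K : ℝ) : Set (IdxIII q ⊕ Fin N → ℂ) :=
  hartogsDomain (RIII q) (fun z => detNorm (matIII z)) N K

def GIII (q N : ℕ) (K lam : ℝ) : (IdxIII q ⊕ Fin N → ℂ) → ℝ :=
  fnG (fun z => detNorm (matIII z)) (q - 1) K lam

def YIV (n N : ℕ) (K : ℝ) : Set (Fin n ⊕ Fin N → ℂ) := hartogsDomain (RIV n) beta N K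

def GIV (n N : ℕ) (K lam : ℝ) : (Fin n ⊕ Fin N → ℂ) → ℝ := fnG beta n K lam

end CartanHartogs

end

/-!
Let `φ = -log h` be the potential on the base `R` and put `c = g + N / K`, so that
`log G_λ = λ log Y + c φ`.

*The base.* In all four cases `R`, with `h` and `g`, satisfies `IsEinsteinBase`: the form
`Φ = ∂∂̄φ` is positive definite and `det Φ` is a constant multiple of `h ^ (-g)`. For matrices
(types I, II, III) Jacobi's formula gives `Φ(V, V) = tr (A⁻¹ V B⁻¹ V̄ᵗ)` with `A = 1 - Z Z̄ᵗ` and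
`B = 1 - Z̄ᵗ Z` (`complexHessian_neg_log_detNorm`). Factoring `A⁻¹ = P̄ᵗ P` and `B⁻¹ = Q Q̄ᵗ` turns
this into the squared Frobenius norm of `P V Q`, so `det Φ` is, up to a constant, the squared
modulus of the determinant of `V ↦ P V Q` on the space of all, of symmetric, or of skew-symmetric
matrices.
That determinant is multiplicative in `P` (and in `Q`), and hence a power of `det P` which can be
read off on diagonal matrices (`MonoidHom.eq_det_pow`). For type IV, `Φ` is `2 / β` times a rank two
perturbation of the identity whose determinant is `1` (`det_rankTwo`).

*The Hartogs domain.* Let `η = ∂φ / K` and `θ_k = dW_k + W_k η`. Then (`complexHessian_fibrePot`)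
`H = ∂∂̄ log Y = (X Y / K) Φ + Y e^{φ/K} ∑ |θ_k|² + Y² e^{2φ/K} |∑ W̄_k θ_k|²`
and the last term is `P = ∂ log Y ∧ ∂̄ log Y`. The coframe `(dz_i, θ_k)` is a unimodular change of
the coordinate coframe, so `T_λ = λ H + c Φ` is positive definite and its determinant is explicit
(`det_adaptedForm`). Since the base is Einstein, with `d` the dimension of `R`,
`log det T_λ = d log A + (N + 1) log Y + c φ + const`, where `A = (λ / K) (Y - 1) + c` is the
coefficient of `Φ` in `T_λ` (`exists_log_det_metricMatrix`).

*Pinching.* Consequently `∂∂̄ log det T_λ = d ∂∂̄ log A + (N + 1) H + c Φ`. As `P ≤ X H` by the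
Cauchy–Schwarz inequality (`gradForm_bounds`), the form `∂∂̄ log A` lies between `0` and a constant
multiple of `H` (`logAffine_bounds`), and comparison with `T_λ = λ H + c Φ` gives both bounds
(`quotient_bounds`).
-/

open scoped ContDiff ComplexOrder

set_option linter.unusedSectionVars false

noncomputable section

namespace CartanHartogs

/-! ### Wirtinger derivatives and the complex Hessian -/

section Wirtinger

variable {κ : Type*} [Fintype κ] [DecidableEq κ]

/-- The first order operator `(∂/∂x_i + c ∂/∂y_i) / 2`, where `z_i = x_i + √-1 y_i`. It is
`∂/∂z_i` for `c = -√-1` and `∂/∂z̄_i` for `c = √-1`. -/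
def wd (c : ℂ) (i : κ) (f : (κ → ℂ) → ℂ) (z : κ → ℂ) : ℂ :=
  (fderiv ℝ f z (Pi.single i 1) + c * fderiv ℝ f z (Pi.single i Complex.I)) / 2

theorem dz_eq_wd (i : κ) : (dz i : ((κ → ℂ) → ℂ) → (κ → ℂ) → ℂ) = wd (-Complex.I) i := by
  funext f z
  simp only [dz, wd]
  ring

theorem dzbar_eq_wd (i : κ) : (dzbar i : ((κ → ℂ) → ℂ) → (κ → ℂ) → ℂ) = wd Complex.I i := rfl

variable {c : ℂ} {i : κ} {f g : (κ → ℂ) → ℂ} {z : κ → ℂ}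

theorem wd_congr (h : f =ᶠ[nhds z] g) : wd c i f z = wd c i g z := by
  simp only [wd, h.fderiv_eq]

theorem wd_const (a : ℂ) : wd c i (fun _ => a) z = 0 := by
  simp [wd]

theorem wd_add (hf : DifferentiableAt ℝ f z) (hg : DifferentiableAt ℝ g z) :
    wd c i (fun w => f w + g w) z = wd c i f z + wd c i g z := by
  simp only [wd, fderiv_fun_add hf hg, add_apply]
  ring

theorem wd_sub (hf : DifferentiableAt ℝ f z) (hg : DifferentiableAt ℝ g z) :
    wd c i (fun w => f w - g w) z = wd c i f z - wd c i g z := by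
  simp only [wd, fderiv_fun_sub hf hg, sub_apply]
  ring

theorem wd_mul (hf : DifferentiableAt ℝ f z) (hg : DifferentiableAt ℝ g z) :
    wd c i (fun w => f w * g w) z = f z * wd c i g z + wd c i f z * g z := by
  simp only [wd, fderiv_fun_mul hf hg, add_apply,
    smul_apply, smul_eq_mul]
  ring

theorem wd_const_mul (a : ℂ) (hf : DifferentiableAt ℝ f z) :
    wd c i (fun w => a * f w) z = a * wd c i f z := by
  rw [wd_mul (differentiableAt_const a) hf, wd_const]
  ring

theorem wd_sum {α : Type*} (s : Finset α) (F : α → (κ → ℂ) → ℂ)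
    (hF : ∀ a ∈ s, DifferentiableAt ℝ (F a) z) :
    wd c i (fun w => ∑ a ∈ s, F a w) z = ∑ a ∈ s, wd c i (F a) z := by
  simp only [wd, fderiv_fun_sum hF, sum_apply, Finset.mul_sum,
    ← Finset.sum_add_distrib, Finset.sum_div]

theorem wd_prod {α : Type*} [DecidableEq α] (s : Finset α) (F : α → (κ → ℂ) → ℂ)
    (hF : ∀ a ∈ s, DifferentiableAt ℝ (F a) z) :
    wd c i (fun w => ∏ a ∈ s, F a w) z =
      ∑ a ∈ s, (∏ b ∈ s.erase a, F b z) * wd c i (F a) z := by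
  have := (HasFDerivAt.finsetProd (u := s) (fun a ha => (hF a ha).hasFDerivAt)).fderiv
  simp only [wd, this, sum_apply, Finset.mul_sum, ← Finset.sum_add_distrib,
    Finset.sum_div, smul_apply, smul_eq_mul]
  exact Finset.sum_congr rfl fun a _ => by ring

theorem wd_ofReal_comp {F : ℝ → ℝ} {F' : ℝ} {u : (κ → ℂ) → ℝ} (hF : HasDerivAt F F' (u z))
    (hu : DifferentiableAt ℝ u z) :
    wd c i (fun w => (F (u w) : ℂ)) z = F' * wd c i (fun w => (u w : ℂ)) z := by
  have h1 := (Complex.ofRealCLM.hasFDerivAt.comp z hu.hasFDerivAt).fderiv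
  have h2 := (Complex.ofRealCLM.hasFDerivAt.comp z (hF.comp_hasFDerivAt z hu.hasFDerivAt)).fderiv
  simp only [Function.comp_def, Complex.ofRealCLM_apply] at h1 h2
  simp only [wd, h1, h2]
  simp
  ring

theorem dz_coord (j : κ) : dz i (fun w => w j) z = if i = j then 1 else 0 := by
  have : fderiv ℝ (fun w : κ → ℂ => w j) z = ContinuousLinearMap.proj (R := ℝ) j :=
    (ContinuousLinearMap.proj (R := ℝ) (φ := fun _ : κ => ℂ) j).fderiv
  by_cases h : i = j
  · subst h; simp [dz, this]
  · simp [dz, this, h, Ne.symm h]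

theorem dzbar_coord (j : κ) : dzbar i (fun w => w j) z = 0 := by
  have : fderiv ℝ (fun w : κ → ℂ => w j) z = ContinuousLinearMap.proj (R := ℝ) j :=
    (ContinuousLinearMap.proj (R := ℝ) (φ := fun _ : κ => ℂ) j).fderiv
  by_cases h : i = j
  · subst h; simp [dzbar, this]
  · simp [dzbar, this, Ne.symm h]

theorem dz_star (hf : DifferentiableAt ℝ f z) :
    dz i (fun w => star (f w)) z = star (dzbar i f z) := by
  have : fderiv ℝ (fun w => star (f w)) z =
      (Complex.conjCLE : ℂ →L[ℝ] ℂ).comp (fderiv ℝ f z) :=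
    ((Complex.conjCLE : ℂ →L[ℝ] ℂ).hasFDerivAt.comp z hf.hasFDerivAt).fderiv
  simp only [dz, dzbar, this]
  simp
  ring

theorem dzbar_star (hf : DifferentiableAt ℝ f z) :
    dzbar i (fun w => star (f w)) z = star (dz i f z) := by
  have : fderiv ℝ (fun w => star (f w)) z =
      (Complex.conjCLE : ℂ →L[ℝ] ℂ).comp (fderiv ℝ f z) :=
    ((Complex.conjCLE : ℂ →L[ℝ] ℂ).hasFDerivAt.comp z hf.hasFDerivAt).fderiv
  simp only [dz, dzbar, this]
  simp

theorem dz_ofReal {u : (κ → ℂ) → ℝ} (hu : DifferentiableAt ℝ u z) :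
    dz i (fun w => (u w : ℂ)) z = star (dzbar i (fun w => (u w : ℂ)) z) := by
  have h : DifferentiableAt ℝ (fun w => (u w : ℂ)) z := Complex.ofRealCLM.differentiableAt.comp z hu
  rw [← dz_star h]
  simp

theorem differentiableAt_wd (hf : ContDiffAt ℝ 2 f z) : DifferentiableAt ℝ (wd c i f) z := by
  have h : DifferentiableAt ℝ (fderiv ℝ f) z :=
    (hf.fderiv_right (m := 1) (by norm_num)).differentiableAt (by norm_num)
  unfold wd
  fun_prop

theorem contDiffAt_ofReal {n : WithTop ℕ∞} {u : (κ → ℂ) → ℝ} (hu : ContDiffAt ℝ n u z) :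
    ContDiffAt ℝ n (fun w => (u w : ℂ)) z :=
  Complex.ofRealCLM.contDiff.contDiffAt.comp z hu

/-- The complex Hessian at a point depends only on the germ of the function there. -/
theorem complexHessian_congr {u v : (κ → ℂ) → ℝ} (h : u =ᶠ[nhds z] v) :
    complexHessian u z = complexHessian v z := by
  ext i j
  simp only [complexHessian, dz_eq_wd, Matrix.of_apply]
  refine wd_congr ?_
  filter_upwards [h.eventuallyEq_nhds] with w hw
  exact wd_congr (hw.fun_comp Complex.ofReal)

theorem complexHessian_apply_congr {u : (κ → ℂ) → ℝ} {j : κ}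
    (h : dzbar j (fun w => (u w : ℂ)) =ᶠ[nhds z] g) :
    complexHessian u z i j = dz i g z := by
  simp only [complexHessian, dz_eq_wd]
  exact wd_congr h

variable {u v : (κ → ℂ) → ℝ}

theorem _root_.ContDiffAt.eventually_differentiableAt {E F : Type*} [NormedAddCommGroup E]
    [NormedSpace ℝ E] [NormedAddCommGroup F] [NormedSpace ℝ F] {f : E → F} {x : E}
    (hf : ContDiffAt ℝ 2 f x) : ∀ᶠ y in nhds x, DifferentiableAt ℝ f y := by
  filter_upwards [hf.eventually (by simp)] with y hy
  exact hy.differentiableAt (by norm_num)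

theorem complexHessian_add (hu : ContDiffAt ℝ 2 u z) (hv : ContDiffAt ℝ 2 v z) :
    complexHessian (fun w => u w + v w) z = complexHessian u z + complexHessian v z := by
  have hu' := contDiffAt_ofReal hu
  have hv' := contDiffAt_ofReal hv
  ext i j
  rw [complexHessian_apply_congr (g := fun w => dzbar j (fun w => (u w : ℂ)) w +
    dzbar j (fun w => (v w : ℂ)) w), dz_eq_wd, wd_add]
  · simp only [complexHessian, dz_eq_wd]; rfl
  · exact differentiableAt_wd hu'
  · exact differentiableAt_wd hv'
  · filter_upwards [hu'.eventually_differentiableAt, hv'.eventually_differentiableAt] with w h1 h2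
    push_cast
    exact wd_add h1 h2

theorem complexHessian_const_mul (a : ℝ) (hu : ContDiffAt ℝ 2 u z) :
    complexHessian (fun w => a * u w) z = (a : ℂ) • complexHessian u z := by
  have hu' := contDiffAt_ofReal hu
  ext i j
  rw [complexHessian_apply_congr (g := fun w => a * dzbar j (fun w => (u w : ℂ)) w), dz_eq_wd,
    wd_const_mul]
  · simp only [complexHessian, dz_eq_wd]; rfl
  · exact differentiableAt_wd hu'
  · filter_upwards [hu'.eventually_differentiableAt] with w h1
    push_cast
    exact wd_const_mul _ h1

theorem complexHessian_const (a : ℝ) : complexHessian (fun _ => a) z = 0 := by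
  ext i j
  rw [complexHessian_apply_congr (g := fun _ => 0), dz_eq_wd, wd_const]
  · rfl
  · exact Filter.Eventually.of_forall fun w => wd_const _

theorem complexHessian_mul (hu : ContDiffAt ℝ 2 u z) (hv : ContDiffAt ℝ 2 v z) :
    complexHessian (fun w => u w * v w) z =
      (u z : ℂ) • complexHessian v z + (v z : ℂ) • complexHessian u z +
        (Matrix.of fun i j => dz i (fun w => (u w : ℂ)) z * dzbar j (fun w => (v w : ℂ)) z) +
        (Matrix.of fun i j => dz i (fun w => (v w : ℂ)) z * dzbar j (fun w => (u w : ℂ)) z) := by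
  have hu' := contDiffAt_ofReal hu
  have hv' := contDiffAt_ofReal hv
  have hu1 := hu'.differentiableAt (by norm_num)
  have hv1 := hv'.differentiableAt (by norm_num)
  ext i j
  have hu2 : DifferentiableAt ℝ (dzbar j fun w => (u w : ℂ)) z := differentiableAt_wd hu'
  have hv2 : DifferentiableAt ℝ (dzbar j fun w => (v w : ℂ)) z := differentiableAt_wd hv'
  rw [complexHessian_apply_congr (g := fun w => u w * dzbar j (fun w => (v w : ℂ)) w +
    dzbar j (fun w => (u w : ℂ)) w * v w), dz_eq_wd, wd_add, wd_mul, wd_mul]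
  · simp only [complexHessian, dz_eq_wd, Matrix.add_apply, Matrix.smul_apply, Matrix.of_apply,
      smul_eq_mul]
    ring
  · exact hu2
  · exact hv1
  · exact hu1
  · exact hv2
  · exact hu1.mul hv2
  · exact hu2.mul hv1
  · filter_upwards [hu'.eventually_differentiableAt, hv'.eventually_differentiableAt] with w h1 h2
    push_cast
    exact wd_mul h1 h2

/-- Chain rule: `∂∂̄ F(u) = F'(u) ∂∂̄u + F''(u) ∂u ∂̄u`. -/
theorem complexHessian_comp {F F' : ℝ → ℝ} {F'' : ℝ} (hu : ContDiffAt ℝ 2 u z)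
    (hF : ∀ᶠ x in nhds (u z), HasDerivAt F (F' x) x) (hF' : HasDerivAt F' F'' (u z)) :
    complexHessian (fun w => F (u w)) z =
      (F' (u z) : ℂ) • complexHessian u z + (F'' : ℂ) •
        (Matrix.of fun i j => dz i (fun w => (u w : ℂ)) z * dzbar j (fun w => (u w : ℂ)) z) := by
  have hu' := contDiffAt_ofReal hu
  have hd := hu.differentiableAt (by norm_num)
  ext i j
  have hu2 : DifferentiableAt ℝ (dzbar j fun w => (u w : ℂ)) z := differentiableAt_wd hu'
  have hF1 : DifferentiableAt ℝ (fun w => (F' (u w) : ℂ)) z :=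
    Complex.ofRealCLM.differentiableAt.comp z (hF'.differentiableAt.comp z hd)
  rw [complexHessian_apply_congr (g := fun w => F' (u w) * dzbar j (fun w => (u w : ℂ)) w),
    dz_eq_wd, wd_mul hF1 hu2, wd_ofReal_comp hF' hd]
  · simp only [complexHessian, dz_eq_wd, Matrix.add_apply, Matrix.smul_apply, Matrix.of_apply,
      smul_eq_mul]
    ring
  · filter_upwards [hu.eventually_differentiableAt, hu.continuousAt.eventually hF] with w h1 h2
    exact wd_ofReal_comp h2 h1

end Wirtinger

/-! ### Derivatives of matrix-valued functions and of `log det (1 - Z Z̄ᵗ)` -/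

section MatrixCalculus

variable {κ : Type*} [Fintype κ] [DecidableEq κ]
variable {m n l : Type*} [Fintype m] [DecidableEq m] [Fintype n] [DecidableEq n]
  [Fintype l] [DecidableEq l]

/-- The operator `wd c i`, applied to each entry of a matrix-valued function. -/
def wdM (c : ℂ) (i : κ) (M : (κ → ℂ) → Matrix m n ℂ) (z : κ → ℂ) : Matrix m n ℂ :=
  Matrix.of fun a b => wd c i (fun w => M w a b) z

/-- All entries of a matrix-valued function are real differentiable at `z`. -/
def MDiffAt (M : (κ → ℂ) → Matrix m n ℂ) (z : κ → ℂ) : Prop :=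
  ∀ a b, DifferentiableAt ℝ (fun w => M w a b) z

/-- All entries of a matrix-valued function are real `C^∞` at `z`. -/
def MSmoothAt (M : (κ → ℂ) → Matrix m n ℂ) (z : κ → ℂ) : Prop :=
  ∀ a b, ContDiffAt ℝ ∞ (fun w => M w a b) z

variable {c : ℂ} {i : κ} {z : κ → ℂ}

theorem MSmoothAt.mDiffAt {M : (κ → ℂ) → Matrix m n ℂ} (h : MSmoothAt M z) : MDiffAt M z :=
  fun a b => (h a b).differentiableAt (by simp)

theorem MSmoothAt.mul {M : (κ → ℂ) → Matrix m n ℂ} {M' : (κ → ℂ) → Matrix n l ℂ}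
    (h : MSmoothAt M z) (h' : MSmoothAt M' z) : MSmoothAt (fun w => M w * M' w) z := by
  intro a b
  simp only [Matrix.mul_apply]
  exact ContDiffAt.sum fun k _ => (h a k).mul (h' k b)

theorem MSmoothAt.conjTranspose {M : (κ → ℂ) → Matrix m n ℂ} (h : MSmoothAt M z) :
    MSmoothAt (fun w => (M w).conjTranspose) z := by
  intro a b
  exact (Complex.conjCLE : ℂ →L[ℝ] ℂ).contDiff.contDiffAt.comp z (h b a)

theorem MSmoothAt.const_sub {M : (κ → ℂ) → Matrix m n ℂ} (C : Matrix m n ℂ) (h : MSmoothAt M z) :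
    MSmoothAt (fun w => C - M w) z := fun a b => contDiffAt_const.sub (h a b)

theorem MSmoothAt.det {M : (κ → ℂ) → Matrix m m ℂ} (h : MSmoothAt M z) :
    ContDiffAt ℝ ∞ (fun w => (M w).det) z := by
  simp only [Matrix.det_apply]
  exact ContDiffAt.sum fun σ _ => (contDiffAt_prod fun k _ => h _ _).const_smul _

theorem MSmoothAt.inv {M : (κ → ℂ) → Matrix m m ℂ} (h : MSmoothAt M z) (h0 : (M z).det ≠ 0) :
    MSmoothAt (fun w => (M w)⁻¹) z := by
  intro a b
  simp only [Matrix.inv_def, Ring.inverse_eq_inv', Matrix.smul_apply, smul_eq_mul,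
    Matrix.adjugate_apply]
  refine (h.det.inv h0).mul (MSmoothAt.det fun x y => ?_)
  by_cases hx : x = b
  · subst hx
    simpa using contDiffAt_const
  · simpa [Matrix.updateRow_ne hx] using h x y

theorem wdM_mul {M : (κ → ℂ) → Matrix m n ℂ} {M' : (κ → ℂ) → Matrix n l ℂ}
    (h : MDiffAt M z) (h' : MDiffAt M' z) :
    wdM c i (fun w => M w * M' w) z = M z * wdM c i M' z + wdM c i M z * M' z := by
  ext a b
  simp only [wdM, Matrix.of_apply, Matrix.mul_apply, Matrix.add_apply]
  rw [wd_sum _ (fun k w => M w a k * M' w k b) fun k _ => (h a k).mul (h' k b),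
    ← Finset.sum_add_distrib]
  exact Finset.sum_congr rfl fun k _ => wd_mul (h a k) (h' k b)

theorem wdM_const (C : Matrix m n ℂ) : wdM c i (fun _ => C) z = 0 := by
  ext a b
  exact wd_const _

theorem wdM_const_sub (C : Matrix m n ℂ) {M : (κ → ℂ) → Matrix m n ℂ} (h : MDiffAt M z) :
    wdM c i (fun w => C - M w) z = -wdM c i M z := by
  ext a b
  simp only [wdM, Matrix.of_apply, Matrix.sub_apply, Matrix.neg_apply]
  rw [wd_sub (differentiableAt_const _) (h a b), wd_const, zero_sub]

theorem wd_trace {M : (κ → ℂ) → Matrix m m ℂ} (h : MDiffAt M z) :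
    wd c i (fun w => (M w).trace) z = (wdM c i M z).trace := by
  simp only [Matrix.trace, Matrix.diag, wdM, Matrix.of_apply]
  exact wd_sum _ _ fun a _ => h a a

/-- Jacobi's formula for the derivative of a determinant. -/
theorem wd_det {M : (κ → ℂ) → Matrix m m ℂ} (h : MDiffAt M z) :
    wd c i (fun w => (M w).det) z = ((M z).adjugate * wdM c i M z).trace := by
  have h1 : ∀ σ : Equiv.Perm m, DifferentiableAt ℝ (fun w => ∏ k, M w (σ k) k) z := fun σ =>
    (HasFDerivAt.finsetProd fun k _ => (h (σ k) k).hasFDerivAt).differentiableAt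
  have h2 : ∀ k : m, ((M z).adjugate * wdM c i M z) k k =
      ((M z).updateCol k fun a => wdM c i M z a k).det := by
    intro k
    rw [← Matrix.cramer_apply, Matrix.cramer_eq_adjugate_mulVec]
    rfl
  simp only [Matrix.trace, Matrix.diag, h2, Matrix.det_apply',
    Finset.sum_comm (s := Finset.univ (α := m))]
  rw [wd_sum _ _ fun σ _ => (h1 σ).const_mul _]
  refine Finset.sum_congr rfl fun σ _ => ?_
  rw [wd_const_mul _ (h1 σ), wd_prod _ _ fun k _ => h _ _, Finset.mul_sum]
  refine Finset.sum_congr rfl fun k _ => ?_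
  rw [← Finset.prod_erase_mul _ _ (Finset.mem_univ k), Matrix.updateCol_self]
  congr 2
  refine Finset.prod_congr rfl fun b hb => ?_
  rw [Matrix.updateCol_ne (Finset.ne_of_mem_erase hb)]

theorem wdM_inv {M : (κ → ℂ) → Matrix m m ℂ} (h : MSmoothAt M z) (h0 : (M z).det ≠ 0) :
    wdM c i (fun w => (M w)⁻¹) z = -((M z)⁻¹ * wdM c i M z * (M z)⁻¹) := by
  have hu : IsUnit (M z).det := isUnit_iff_ne_zero.2 h0
  have h1 : wdM c i (fun w => (M w)⁻¹ * M w) z = 0 := by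
    rw [← wdM_const (c := c) (i := i) (z := z) (1 : Matrix m m ℂ)]
    ext a b
    refine wd_congr ?_
    filter_upwards [h.det.continuousAt.eventually_ne h0] with w hw
    rw [Matrix.nonsing_inv_mul _ (isUnit_iff_ne_zero.2 hw)]
  rw [wdM_mul (h.inv h0).mDiffAt h.mDiffAt] at h1
  calc wdM c i (fun w => (M w)⁻¹) z = wdM c i (fun w => (M w)⁻¹) z * M z * (M z)⁻¹ := by
        rw [Matrix.mul_assoc, Matrix.mul_nonsing_inv _ hu, Matrix.mul_one]
    _ = -((M z)⁻¹ * wdM c i M z * (M z)⁻¹) := by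
        rw [eq_neg_of_add_eq_zero_right h1, Matrix.neg_mul]

end MatrixCalculus

section LinearEmbedding

variable {κ : Type*} [Fintype κ] [DecidableEq κ] {m n : ℕ}
variable (E : (κ → ℂ) →ₗ[ℂ] Matrix (Fin m) (Fin n) ℂ) {z : κ → ℂ} {i j : κ}

theorem det_one_sub_mul_conjTranspose (Z : Matrix (Fin m) (Fin n) ℂ) :
    (1 - Z * Z.conjTranspose).det = (detNorm Z : ℂ) := by
  have h : star (1 - Z * Z.conjTranspose).det = (1 - Z * Z.conjTranspose).det := by
    rw [← Matrix.det_conjTranspose]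
    simp
  exact (Complex.conj_eq_iff_re.1 h).symm

theorem hasFDerivAt_linear (ℓ : (κ → ℂ) →ₗ[ℂ] ℂ) :
    HasFDerivAt (fun w => ℓ w) ((LinearMap.toContinuousLinearMap ℓ).restrictScalars ℝ) z :=
  ((LinearMap.toContinuousLinearMap ℓ).restrictScalars ℝ).hasFDerivAt

theorem single_I (i : κ) : (Pi.single i Complex.I : κ → ℂ) = Complex.I • Pi.single i 1 := by
  rw [← Pi.single_smul, smul_eq_mul, mul_one]

theorem dz_linear (ℓ : (κ → ℂ) →ₗ[ℂ] ℂ) : dz i (fun w => ℓ w) z = ℓ (Pi.single i 1) := by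
  simp only [dz, (hasFDerivAt_linear ℓ).fderiv, single_I]
  simp [← mul_assoc]

theorem dzbar_linear (ℓ : (κ → ℂ) →ₗ[ℂ] ℂ) : dzbar i (fun w => ℓ w) z = 0 := by
  simp only [dzbar, (hasFDerivAt_linear ℓ).fderiv, single_I]
  simp [← mul_assoc]

/-- The matrix entry functional `(a, b)` composed with a linear parametrization. -/
def entryOf (a : Fin m) (b : Fin n) : (κ → ℂ) →ₗ[ℂ] ℂ where
  toFun w := E w a b
  map_add' := by simp
  map_smul' := by simp

theorem mSmoothAt_linear : MSmoothAt (fun w => E w) z := fun a b =>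
  ((LinearMap.toContinuousLinearMap (entryOf E a b)).restrictScalars ℝ).contDiff.contDiffAt

theorem mSmoothAt_one_sub :
    MSmoothAt (fun w => 1 - E w * (E w).conjTranspose) z :=
  ((mSmoothAt_linear E).mul (mSmoothAt_linear E).conjTranspose).const_sub 1

theorem contDiffAt_detNorm : ContDiffAt ℝ ∞ (fun w => detNorm (E w)) z :=
  Complex.reCLM.contDiff.contDiffAt.comp z (mSmoothAt_one_sub E).det

theorem dzM_linear : wdM (-Complex.I) i (fun w => E w) z = E (Pi.single i 1) := by
  ext a b
  simp only [wdM, ← dz_eq_wd]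
  exact dz_linear (entryOf E a b)

theorem dzbarM_linear : wdM Complex.I i (fun w => E w) z = 0 := by
  ext a b
  exact dzbar_linear (entryOf E a b)

theorem dzM_linear_conj : wdM (-Complex.I) i (fun w => (E w).conjTranspose) z = 0 := by
  ext a b
  simp only [wdM, ← dz_eq_wd, Matrix.of_apply, Matrix.conjTranspose_apply]
  rw [dz_star ((mSmoothAt_linear E).mDiffAt b a)]
  exact (congrArg star (dzbar_linear (entryOf E b a))).trans (star_zero _)

theorem dzbarM_linear_conj : wdM Complex.I i (fun w => (E w).conjTranspose) z =
    (E (Pi.single i 1)).conjTranspose := by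
  ext a b
  simp only [wdM, ← dzbar_eq_wd, Matrix.of_apply, Matrix.conjTranspose_apply]
  rw [dzbar_star ((mSmoothAt_linear E).mDiffAt b a)]
  exact congrArg star (dz_linear (entryOf E b a))

theorem dzM_one_sub : wdM (-Complex.I) i (fun w => 1 - E w * (E w).conjTranspose) z =
    -(E (Pi.single i 1) * (E z).conjTranspose) := by
  have h := mSmoothAt_linear E (z := z)
  rw [wdM_const_sub _ (h.mul h.conjTranspose).mDiffAt, wdM_mul h.mDiffAt h.conjTranspose.mDiffAt,
    dzM_linear, dzM_linear_conj]
  simp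

theorem dzbarM_one_sub : wdM Complex.I i (fun w => 1 - E w * (E w).conjTranspose) z =
    -(E z * (E (Pi.single i 1)).conjTranspose) := by
  have h := mSmoothAt_linear E (z := z)
  rw [wdM_const_sub _ (h.mul h.conjTranspose).mDiffAt, wdM_mul h.mDiffAt h.conjTranspose.mDiffAt,
    dzbarM_linear, dzbarM_linear_conj]
  simp

theorem dzbar_neg_log_detNorm (h0 : detNorm (E z) ≠ 0) :
    dzbar j (fun w => ((-Real.log (detNorm (E w)) : ℝ) : ℂ)) z =
      ((1 - E z * (E z).conjTranspose)⁻¹ * E z * (E (Pi.single j 1)).conjTranspose).trace := by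
  have h1 : (fun w => (detNorm (E w) : ℂ)) = fun w => (1 - E w * (E w).conjTranspose).det :=
    funext fun w => (det_one_sub_mul_conjTranspose (E w)).symm
  rw [dzbar_eq_wd, wd_ofReal_comp (F := fun x => -Real.log x) (Real.hasDerivAt_log h0).neg
    ((contDiffAt_detNorm E).differentiableAt (by simp)), h1,
    wd_det (mSmoothAt_one_sub E).mDiffAt, dzbarM_one_sub, Matrix.inv_def,
    det_one_sub_mul_conjTranspose, Ring.inverse_eq_inv']
  simp [Matrix.mul_assoc]

theorem one_add_mul_inv_mul (Z : Matrix (Fin m) (Fin n) ℂ)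
    (h : (1 - Z * Z.conjTranspose).det ≠ 0) :
    1 + Z.conjTranspose * (1 - Z * Z.conjTranspose)⁻¹ * Z = (1 - Z.conjTranspose * Z)⁻¹ := by
  set A := 1 - Z * Z.conjTranspose with hA
  have hu : A * A⁻¹ = 1 := Matrix.mul_nonsing_inv _ (isUnit_iff_ne_zero.2 h)
  refine (Matrix.inv_eq_right_inv ?_).symm
  have h1 : (1 - Z.conjTranspose * Z) * Z.conjTranspose = Z.conjTranspose * A := by
    rw [hA, Matrix.sub_mul, Matrix.mul_sub]
    simp [Matrix.mul_assoc]
  calc (1 - Z.conjTranspose * Z) * (1 + Z.conjTranspose * A⁻¹ * Z)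
      = (1 - Z.conjTranspose * Z) + (1 - Z.conjTranspose * Z) * Z.conjTranspose * A⁻¹ * Z := by
        rw [Matrix.mul_add, Matrix.mul_one]
        simp only [Matrix.mul_assoc]
    _ = 1 := by
        rw [h1, Matrix.mul_assoc _ A, hu, Matrix.mul_one]
        simp

/-- The complex Hessian of `-log det (1 - Z Z̄ᵗ)` is the form `tr (A⁻¹ V B⁻¹ V̄ᵗ)` with
`A = 1 - Z Z̄ᵗ` and `B = 1 - Z̄ᵗ Z`, restricted to the image of the parametrization. -/
theorem complexHessian_neg_log_detNorm (h0 : detNorm (E z) ≠ 0) :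
    complexHessian (fun w => -Real.log (detNorm (E w))) z i j =
      ((1 - E z * (E z).conjTranspose)⁻¹ * E (Pi.single i 1) *
        (1 - (E z).conjTranspose * E z)⁻¹ * (E (Pi.single j 1)).conjTranspose).trace := by
  have hd : (1 - E z * (E z).conjTranspose).det ≠ 0 := by
    rw [det_one_sub_mul_conjTranspose]
    exact_mod_cast h0
  have hA := mSmoothAt_one_sub E (z := z)
  have hE := mSmoothAt_linear E (z := z)
  have hc : MSmoothAt (fun _ : κ → ℂ => (E (Pi.single j 1)).conjTranspose) z :=
    fun a b => contDiffAt_const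
  rw [complexHessian_apply_congr (g := fun w => ((1 - E w * (E w).conjTranspose)⁻¹ * E w *
    (E (Pi.single j 1)).conjTranspose).trace), dz_eq_wd,
    wd_trace (((hA.inv hd).mul hE).mul hc).mDiffAt,
    wdM_mul ((hA.inv hd).mul hE).mDiffAt hc.mDiffAt, wdM_const,
    wdM_mul (hA.inv hd).mDiffAt hE.mDiffAt,
    wdM_inv hA hd, dzM_one_sub, dzM_linear, ← one_add_mul_inv_mul _ hd]
  · congr 1
    simp only [Matrix.mul_add, Matrix.add_mul, Matrix.mul_neg, Matrix.neg_mul, neg_neg,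
      Matrix.mul_zero, zero_add, Matrix.mul_one, Matrix.mul_assoc]
  · filter_upwards [(contDiffAt_detNorm E).continuousAt.eventually_ne h0] with w hw
    exact dzbar_neg_log_detNorm E hw

end LinearEmbedding

/-! ### Multiplicative functions of matrices, Gram matrices and Einstein bases -/

section Determinants

variable {n : Type*} [Fintype n] [DecidableEq n]

theorem diagonal_mul_transvection_mul_diagonal {i j : n} (hij : i ≠ j) (a : ℂ) :
    Matrix.diagonal (Function.update 1 i 2) * Matrix.transvection i j a *
      Matrix.diagonal (Function.update 1 i (2⁻¹ : ℂ)) = Matrix.transvection i j (2 * a) := by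
  ext k l
  rw [Matrix.mul_diagonal, Matrix.diagonal_mul]
  simp only [Matrix.transvection, Matrix.add_apply, Matrix.one_apply, Matrix.single_apply,
    Function.update_apply, Pi.one_apply]
  grind

/-- A multiplicative function on matrices which is the `k`-th power of the determinant on diagonal
matrices is so everywhere: it is `1` on a transvection, since a transvection is conjugate to its
own square by a diagonal matrix. -/
theorem MonoidHom.eq_det_pow (D : Matrix n n ℂ →* ℂ) (k : ℕ)
    (hD : ∀ d : n → ℂ, D (Matrix.diagonal d) = (∏ i, d i) ^ k) (M : Matrix n n ℂ) :
    D M = M.det ^ k := by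
  refine Matrix.diagonal_transvection_induction (fun M => D M = M.det ^ k) M
    (fun d _ => by rw [hD, Matrix.det_diagonal]) (fun t => ?_)
    (fun A B hA hB => by rw [map_mul, hA, hB, Matrix.det_mul, mul_pow])
  obtain ⟨i, j, hij, a⟩ := t
  simp only [Matrix.TransvectionStruct.toMatrix]
  have hdd : D (Matrix.diagonal (Function.update 1 i (2 : ℂ))) *
      D (Matrix.diagonal (Function.update 1 i (2⁻¹ : ℂ))) = 1 := by
    rw [hD, hD, ← mul_pow, ← Finset.prod_mul_distrib]
    rw [Finset.prod_eq_one, one_pow]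
    intro l _
    by_cases h : l = i
    · subst h; simp
    · simp [h]
  -- conjugation by `diag (1, …, 2, …, 1)` doubles the parameter, that is, squares the transvection
  have h1 : D (Matrix.transvection i j a) * D (Matrix.transvection i j a) =
      D (Matrix.transvection i j a) := by
    rw [← map_mul, Matrix.transvection_mul_transvection_same _ _ hij, ← two_mul,
      ← diagonal_mul_transvection_mul_diagonal hij, map_mul, map_mul, mul_right_comm, hdd, one_mul]
  have h2 : D (Matrix.transvection i j a) * D (Matrix.transvection i j (-a)) = 1 := by
    rw [← map_mul, Matrix.transvection_mul_transvection_same _ _ hij]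
    simp
  have h3 : D (Matrix.transvection i j a) ≠ 0 := left_ne_zero_of_mul_eq_one h2
  rw [Matrix.det_transvection_of_ne _ _ hij, one_pow]
  exact (mul_eq_left₀ h3).1 h1

variable {κ : Type*} [Fintype κ] [DecidableEq κ] {V : Type*} [AddCommGroup V] [Module ℂ V]

/-- If a family `ρ` of endomorphisms of `V` is multiplicative in a matrix parameter and restricts
through an injection `E` to endomorphisms `S P` of `ℂ^κ`, and if `S` maps diagonal matrices to
coordinate scalings, then `det (S P)` is a power of `det P`. -/
theorem det_eq_det_pow_of_intertwining (E : (κ → ℂ) →ₗ[ℂ] V) (hE : Function.Injective E)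
    (ρ : Matrix n n ℂ →* Module.End ℂ V) (S : Matrix n n ℂ → Module.End ℂ (κ → ℂ))
    (hS : ∀ P v, E (S P v) = ρ P (E v)) (k : ℕ) (χ : (n → ℂ) → κ → ℂ)
    (hχ : ∀ d v, S (Matrix.diagonal d) v = χ d * v) (hk : ∀ d, ∏ x, χ d x = (∏ i, d i) ^ k)
    (P : Matrix n n ℂ) : LinearMap.det (S P) = P.det ^ k := by
  let D : Matrix n n ℂ →* ℂ :=
    { toFun := fun P => LinearMap.det (S P)
      map_one' := by
        have : S 1 = 1 := LinearMap.ext fun v => hE (by simp [hS])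
        rw [this, map_one]
      map_mul' := fun P Q => by
        have : S (P * Q) = S P * S Q := LinearMap.ext fun v => hE (by simp [hS])
        rw [this, map_mul] }
  refine MonoidHom.eq_det_pow D k (fun d => ?_) P
  have : S (Matrix.diagonal d) = Matrix.toLin' (Matrix.diagonal (χ d)) := by
    refine LinearMap.ext fun v => ?_
    rw [hχ]
    ext x
    simp [Matrix.mulVec_diagonal]
  change LinearMap.det (S (Matrix.diagonal d)) = _
  rw [this, LinearMap.det_toLin', Matrix.det_diagonal, hk]

end Determinants

section Bases

/-- `h` is a positive smooth function on the open set `R` such that `-log h` is the potential of a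
Kähler metric whose volume form is a constant multiple of `h ^ (-g)`; this metric is then
Kähler–Einstein. -/
structure IsEinsteinBase {ι : Type*} [Fintype ι] [DecidableEq ι] (R : Set (ι → ℂ))
    (h : (ι → ℂ) → ℝ) (g : ℝ) : Prop where
  isOpen : IsOpen R
  pos : ∀ z ∈ R, 0 < h z
  smooth : ∀ z ∈ R, ContDiffAt ℝ ∞ h z
  posDef : ∀ z ∈ R, (complexHessian (fun w => -Real.log (h w)) z).PosDef
  det_eq : ∃ c : ℝ, 0 < c ∧ ∀ z ∈ R,
    (complexHessian (fun w => -Real.log (h w)) z).det = ((c * h z ^ (-g) : ℝ) : ℂ)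

theorem posDef_iff_forall_sphere {n : Type*} [Fintype n] {A : Matrix n n ℂ} (hA : A.IsHermitian) :
    A.PosDef ↔ ∀ v ∈ Metric.sphere (0 : n → ℂ) 1, 0 < (star v ⬝ᵥ A.mulVec v).re := by
  constructor
  · intro h v hv
    exact (Complex.lt_def.1 (h.dotProduct_mulVec_pos (ne_zero_of_mem_unit_sphere ⟨v, hv⟩))).1
  · intro h
    refine Matrix.PosDef.of_dotProduct_mulVec_pos hA fun v hv => ?_
    have him : (star v ⬝ᵥ A.mulVec v).im = 0 := hA.im_star_dotProduct_mulVec_self v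
    have h1 := h ((‖v‖⁻¹ : ℝ) • v) (by simp [norm_smul, hv])
    rw [Matrix.mulVec_smul, dotProduct_smul, star_smul, smul_dotProduct] at h1
    simp only [star_trivial, Complex.smul_re, smul_eq_mul] at h1
    have hp : 0 < ‖v‖⁻¹ := inv_pos.2 (norm_pos_iff.2 hv)
    rw [Complex.lt_def]
    exact ⟨pos_of_mul_pos_right (pos_of_mul_pos_right h1 hp.le) hp.le, by simp [him]⟩

/-- By compactness of the unit sphere, positive definiteness is an open condition. -/
theorem isOpen_setOf_posDef {X n : Type*} [TopologicalSpace X] [Fintype n]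
    {A : X → Matrix n n ℂ} (hA : Continuous A) (hH : ∀ x, (A x).IsHermitian) :
    IsOpen {x | (A x).PosDef} := by
  rw [isOpen_iff_mem_nhds]
  intro x hx
  simp only [Set.mem_ofPred_eq, posDef_iff_forall_sphere (hH _)] at hx
  have hc : Continuous fun p : X × (n → ℂ) => (star p.2 ⬝ᵥ (A p.1).mulVec p.2).re :=
    Complex.continuous_re.comp ((continuous_star.comp continuous_snd).dotProduct
      ((hA.comp continuous_fst).matrix_mulVec continuous_snd))
  have := (isCompact_sphere (0 : n → ℂ) 1).eventually_forall_of_forall_eventually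
    (x₀ := x) (P := fun y v => 0 < (star v ⬝ᵥ (A y).mulVec v).re)
    fun v hv => hc.continuousAt.eventually (lt_mem_nhds (hx v hv))
  filter_upwards [this] with y hy
  exact (posDef_iff_forall_sphere (hH y)).2 hy

variable {κ : Type*} [Fintype κ] [DecidableEq κ] {m n : ℕ}

/-- The Gram matrix of a linear map into matrices, for the Hermitian product `tr (X Ȳᵗ)`. -/
def gramMatrix (F : (κ → ℂ) →ₗ[ℂ] Matrix (Fin m) (Fin n) ℂ) : Matrix κ κ ℂ :=
  Matrix.of fun i j => (F (Pi.single i 1) * (F (Pi.single j 1)).conjTranspose).trace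

theorem map_eq_sum {V : Type*} [AddCommGroup V] [Module ℂ V] (F : (κ → ℂ) →ₗ[ℂ] V) (v : κ → ℂ) :
    F v = ∑ i, v i • F (Pi.single i 1) := by
  conv_lhs => rw [pi_eq_sum_univ' v, map_sum]
  refine Finset.sum_congr rfl fun i _ => ?_
  rw [map_smul]

theorem posDef_gramMatrix (F : (κ → ℂ) →ₗ[ℂ] Matrix (Fin m) (Fin n) ℂ)
    (hF : Function.Injective F) : (gramMatrix F).PosDef := by
  refine Matrix.PosDef.of_dotProduct_mulVec_pos ?_ fun x hx => ?_
  · ext i j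
    simp only [gramMatrix, Matrix.conjTranspose_apply, Matrix.of_apply]
    rw [← Matrix.trace_conjTranspose]
    simp
  · have h1 : star x ⬝ᵥ (gramMatrix F).mulVec x =
        (F (star x) * (F (star x)).conjTranspose).trace := by
      rw [map_eq_sum F (star x)]
      simp only [Matrix.conjTranspose_sum, Matrix.conjTranspose_smul, Matrix.sum_mul,
        Matrix.mul_sum, Matrix.trace_sum, dotProduct, Matrix.mulVec, gramMatrix, Matrix.of_apply,
        Matrix.smul_mul, Matrix.mul_smul, Matrix.trace_smul, smul_eq_mul, Pi.star_apply, star_star]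
      simp only [Finset.mul_sum]
      rw [Finset.sum_comm]
      exact Finset.sum_congr rfl fun i _ => Finset.sum_congr rfl fun j _ => by ring
    rw [h1]
    refine lt_of_le_of_ne (Matrix.posSemidef_self_mul_conjTranspose _).trace_nonneg (Ne.symm ?_)
    rw [Ne, Matrix.trace_mul_conjTranspose_self_eq_zero_iff, map_eq_zero_iff F hF, star_eq_zero]
    exact hx

theorem gramMatrix_comp (F : (κ → ℂ) →ₗ[ℂ] Matrix (Fin m) (Fin n) ℂ)
    (S : Module.End ℂ (κ → ℂ)) :
    gramMatrix (F ∘ₗ S) = (LinearMap.toMatrix' S).transpose * gramMatrix F *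
      (LinearMap.toMatrix' S).map star := by
  ext i j
  simp only [gramMatrix, LinearMap.comp_apply, Matrix.of_apply]
  rw [map_eq_sum F (S (Pi.single i 1)), map_eq_sum F (S (Pi.single j 1))]
  simp only [Matrix.mul_apply, Matrix.transpose_apply, Matrix.map_apply, LinearMap.toMatrix'_apply,
    Matrix.conjTranspose_sum, Matrix.conjTranspose_smul, Matrix.sum_mul,
    Matrix.mul_sum, Matrix.trace_sum, Matrix.of_apply,
    Matrix.smul_mul, Matrix.mul_smul, Matrix.trace_smul, smul_eq_mul]
  exact Finset.sum_congr rfl fun k _ => mul_comm _ _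

theorem det_gramMatrix_comp (F : (κ → ℂ) →ₗ[ℂ] Matrix (Fin m) (Fin n) ℂ)
    (S : Module.End ℂ (κ → ℂ)) :
    (gramMatrix (F ∘ₗ S)).det = (‖LinearMap.det S‖ ^ 2 : ℝ) * (gramMatrix F).det := by
  have h : ((LinearMap.toMatrix' S).map star).det = star (LinearMap.det S) := by
    rw [← LinearMap.det_toMatrix', ← Matrix.det_conjTranspose, ← Matrix.det_transpose]
    rfl
  rw [gramMatrix_comp, Matrix.det_mul, Matrix.det_mul, h, Matrix.det_transpose,
    LinearMap.det_toMatrix', mul_right_comm]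
  congr 1
  simpa using Complex.mul_conj' (LinearMap.det S)

/-- The Hessian of `-log det (1 - Z Z̄ᵗ)` on a linear space of matrices is the pull-back of the
Hermitian product `tr (X Ȳᵗ)` by `V ↦ P V Q`, where `P`, `Q` factor `(1 - Z Z̄ᵗ)⁻¹` and
`(1 - Z̄ᵗ Z)⁻¹`. If that map is induced by an endomorphism `S` of the coordinate space, then the
determinant of the Hessian is `|det S|²` times a constant. -/
theorem isEinsteinBase_of_linear (E : (κ → ℂ) →ₗ[ℂ] Matrix (Fin m) (Fin n) ℂ)
    (hE : Function.Injective E) (g : ℝ)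
    (hS : ∀ z, (1 - E z * (E z).conjTranspose).PosDef →
      ∃ (P : Matrix (Fin m) (Fin m) ℂ) (Q : Matrix (Fin n) (Fin n) ℂ) (S : Module.End ℂ (κ → ℂ)),
        (1 - E z * (E z).conjTranspose)⁻¹ = P.conjTranspose * P ∧
        (1 - (E z).conjTranspose * E z)⁻¹ = Q * Q.conjTranspose ∧
        (∀ v, E (S v) = P * E v * Q) ∧ ‖LinearMap.det S‖ ^ 2 = detNorm (E z) ^ (-g)) :
    IsEinsteinBase {z | (1 - E z * (E z).conjTranspose).PosDef} (fun z => detNorm (E z)) g := by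
  have hcont : Continuous fun w => E w := LinearMap.continuous_of_finiteDimensional E
  have hpos : ∀ z, (1 - E z * (E z).conjTranspose).PosDef → 0 < detNorm (E z) := fun z hz => by
    have := hz.det_pos
    rw [det_one_sub_mul_conjTranspose] at this
    exact_mod_cast this
  have key : ∀ z, (1 - E z * (E z).conjTranspose).PosDef → ∃ S : Module.End ℂ (κ → ℂ),
      complexHessian (fun w => -Real.log (detNorm (E w))) z = gramMatrix (E ∘ₗ S) ∧
      ‖LinearMap.det S‖ ^ 2 = detNorm (E z) ^ (-g) := fun z hz => by
    obtain ⟨P, Q, S, hP, hQ, hPQ, hdet⟩ := hS z hz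
    refine ⟨S, ?_, hdet⟩
    ext i j
    rw [complexHessian_neg_log_detNorm E (hpos z hz).ne', hP, hQ]
    simp only [gramMatrix, Matrix.of_apply, LinearMap.comp_apply, hPQ, Matrix.conjTranspose_mul]
    rw [Matrix.mul_assoc, Matrix.mul_assoc, Matrix.mul_assoc, Matrix.trace_mul_comm]
    simp only [Matrix.mul_assoc]
  have hSinj : ∀ z, (1 - E z * (E z).conjTranspose).PosDef → ∀ S : Module.End ℂ (κ → ℂ),
      ‖LinearMap.det S‖ ^ 2 = detNorm (E z) ^ (-g) → Function.Injective (E ∘ₗ S) :=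
    fun z hz S hdet => by
    have h0 : LinearMap.det S ≠ 0 := by
      intro h
      rw [h] at hdet
      have := Real.rpow_pos_of_pos (hpos z hz) (-g)
      simp at hdet
      linarith
    rw [LinearMap.coe_comp]
    refine hE.comp ?_
    exact ((LinearMap.equivOfDetNeZero S h0).injective : _)
  have hΓ := (posDef_gramMatrix E hE).det_pos
  refine ⟨isOpen_setOf_posDef (by fun_prop) fun z => ?_, hpos, fun z _ => contDiffAt_detNorm E,
    fun z hz => ?_, (gramMatrix E).det.re, (Complex.lt_def.1 hΓ).1, fun z hz => ?_⟩
  · exact Matrix.isHermitian_one.sub (Matrix.isHermitian_mul_conjTranspose_self _)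
  · obtain ⟨S, hS, hdet⟩ := key z hz
    rw [hS]
    exact posDef_gramMatrix _ (hSinj z hz S hdet)
  · obtain ⟨S, hS, hdet⟩ := key z hz
    have him : ((gramMatrix E).det.re : ℂ) = (gramMatrix E).det :=
      Complex.ext rfl (Complex.lt_def.1 hΓ).2
    rw [hS, det_gramMatrix_comp, hdet]
    push_cast
    rw [him, mul_comm]

end Bases

/-! ### The classical domains of types I, II and III -/

section MatrixDomains

open scoped MatrixOrder in
theorem exists_conjTranspose_mul_self {n : Type*} [Fintype n] [DecidableEq n] {M : Matrix n n ℂ}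
    (hM : M.PosSemidef) : ∃ P : Matrix n n ℂ, M = P.conjTranspose * P :=
  CStarAlgebra.nonneg_iff_eq_star_mul_self.mp hM.nonneg

variable {m n : ℕ}

theorem norm_det_sq_of_inv_eq {Z : Matrix (Fin m) (Fin n) ℂ} {l : Type*} [Fintype l]
    [DecidableEq l] {B P : Matrix l l ℂ} (hB : B.det = detNorm Z)
    (hP : B⁻¹ = P.conjTranspose * P) : ‖P.det‖ ^ 2 = (detNorm Z)⁻¹ := by
  have h := congrArg Matrix.det hP
  rw [Matrix.det_mul, Matrix.det_conjTranspose, Matrix.det_nonsing_inv, hB,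
    Ring.inverse_eq_inv'] at h
  have h2 : star P.det * P.det = ((‖P.det‖ ^ 2 : ℝ) : ℂ) := by
    simpa using Complex.conj_mul' P.det
  rw [h2] at h
  exact_mod_cast h.symm

/-! ### Type I -/

/-- `matI` as a linear map. -/
def linI (m n : ℕ) : (IdxI m n → ℂ) →ₗ[ℂ] Matrix (Fin m) (Fin n) ℂ where
  toFun := matI
  map_add' _ _ := rfl
  map_smul' _ _ := rfl

theorem linI_apply (v : IdxI m n → ℂ) (i : Fin m) (j : Fin n) : linI m n v i j = v (i, j) := rfl

theorem linI_injective : Function.Injective (linI m n) := fun v w h => by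
  ext ⟨i, j⟩
  exact congrFun (congrFun h i) j

/-- Coordinates of `P Z Q`, as a function of the coordinates of `Z`. -/
def actI (P : Matrix (Fin m) (Fin m) ℂ) (Q : Matrix (Fin n) (Fin n) ℂ) :
    Module.End ℂ (IdxI m n → ℂ) where
  toFun v x := (P * linI m n v * Q) x.1 x.2
  map_add' v w := by
    ext x
    simp [Matrix.mul_add, Matrix.add_mul]
  map_smul' c v := by
    ext x
    simp

theorem linI_actI (P : Matrix (Fin m) (Fin m) ℂ) (Q : Matrix (Fin n) (Fin n) ℂ)
    (v : IdxI m n → ℂ) : linI m n (actI P Q v) = P * linI m n v * Q := rfl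

theorem det_actI (P : Matrix (Fin m) (Fin m) ℂ) (Q : Matrix (Fin n) (Fin n) ℂ) :
    LinearMap.det (actI P Q) = P.det ^ n * Q.det ^ m := by
  have h1 : LinearMap.det (actI P (1 : Matrix (Fin n) (Fin n) ℂ)) = P.det ^ n := by
    refine det_eq_det_pow_of_intertwining (linI m n) linI_injective
      { toFun := fun P =>
          { toFun := fun M => P * M
            map_add' := Matrix.mul_add P
            map_smul' := fun c M => Matrix.mul_smul P c M }
        map_one' := by ext1 M; exact Matrix.one_mul M
        map_mul' := fun P Q => by ext1 M; exact Matrix.mul_assoc P Q M }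
      (fun P => actI P 1) (fun P v => by simp [linI_actI]) n (fun d x => d x.1)
      (fun d v => ?_) (fun d => ?_) P
    · ext x
      simp [actI, linI_apply]
    · simp [Fintype.prod_prod_type, Finset.prod_pow]
  have h2 : LinearMap.det (actI (1 : Matrix (Fin m) (Fin m) ℂ) Q.transpose.transpose) =
      Q.transpose.det ^ m := by
    refine det_eq_det_pow_of_intertwining (linI m n) linI_injective
      { toFun := fun Q =>
          { toFun := fun M => M * Q.transpose
            map_add' := fun M N => Matrix.add_mul M N Q.transpose
            map_smul' := fun c M => Matrix.smul_mul c M Q.transpose }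
        map_one' := by ext1 M; simp
        map_mul' := fun P Q => by ext1 M; simp [Matrix.mul_assoc] }
      (fun Q => actI 1 Q.transpose) (fun P v => by simp [linI_actI]) m (fun d x => d x.2)
      (fun d v => ?_) (fun d => ?_) Q.transpose
    · ext x
      simp [actI, linI_apply, mul_comm]
    · simp [Fintype.prod_prod_type]
  have h3 : actI P Q = actI P 1 * actI 1 Q := by
    refine LinearMap.ext fun v => linI_injective ?_
    simp [linI_actI, Matrix.mul_assoc]
  rw [h3, map_mul, h1, ← Matrix.det_transpose Q, ← h2, Matrix.transpose_transpose]

theorem isEinsteinBase_RI (m n : ℕ) :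
    IsEinsteinBase (RI m n) (fun z => detNorm (matI z)) (m + n) := by
  refine isEinsteinBase_of_linear (linI m n) linI_injective (m + n) fun z hz => ?_
  set Z := linI m n z with hZ
  have hd : 0 < detNorm Z := by
    have := hz.det_pos
    rw [det_one_sub_mul_conjTranspose] at this
    exact_mod_cast this
  obtain ⟨P, hP⟩ := exists_conjTranspose_mul_self hz.inv.posSemidef
  have hB : ((1 - Z.conjTranspose * Z)⁻¹).PosSemidef := by
    rw [← one_add_mul_inv_mul Z hz.det_pos.ne']
    exact Matrix.PosSemidef.one.add (hz.inv.posSemidef.conjTranspose_mul_mul_same Z)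
  obtain ⟨Q, hQ⟩ := exists_conjTranspose_mul_self hB
  refine ⟨P, Q.conjTranspose, actI P Q.conjTranspose, hP, by
      rw [hQ, Matrix.conjTranspose_conjTranspose],
    linI_actI P _, ?_⟩
  have h1 := norm_det_sq_of_inv_eq (det_one_sub_mul_conjTranspose Z) hP
  have h2 := norm_det_sq_of_inv_eq
    ((Matrix.det_one_sub_mul_comm _ _).trans (det_one_sub_mul_conjTranspose Z)) hQ
  rw [det_actI, norm_mul, norm_pow, norm_pow, Matrix.det_conjTranspose, norm_star, mul_pow,
    pow_right_comm, h1, pow_right_comm, h2, ← pow_add, Real.rpow_neg hd.le, inv_pow,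
    ← Nat.cast_add, Real.rpow_natCast, add_comm]

/-! ### Types II and III -/

/-- Congruence `M ↦ P M Pᵗ`, multiplicative in `P`. -/
def congruence (p : ℕ) :
    Matrix (Fin p) (Fin p) ℂ →* Module.End ℂ (Matrix (Fin p) (Fin p) ℂ) where
  toFun P :=
    { toFun := fun M => P * M * P.transpose
      map_add' := fun M N => by rw [Matrix.mul_add, Matrix.add_mul]
      map_smul' := fun c M => by simp }
  map_one' := by ext1 M; simp
  map_mul' P Q := by ext1 M; simp [Matrix.mul_assoc]

theorem congruence_apply {p : ℕ} (P M : Matrix (Fin p) (Fin p) ℂ) :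
    congruence p P M = P * M * P.transpose := rfl

/-- The case of a linear space of square matrices with `Zᵗ = ε Z`, stable under congruence. Here
`1 - Z̄ᵗ Z` is the transpose of `1 - Z Z̄ᵗ`, so that `Q = Pᵗ` is a possible choice, and the
endomorphism of the coordinate space is the congruence `V ↦ P V Pᵗ`. -/
theorem isEinsteinBase_of_congruence {κ : Type*} [Fintype κ] [DecidableEq κ] {p : ℕ}
    (E : (κ → ℂ) →ₗ[ℂ] Matrix (Fin p) (Fin p) ℂ) (hE : Function.Injective E) (ε : ℂ)
    (hε : star ε * ε = 1) (hsymm : ∀ v, (E v).transpose = ε • E v)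
    (S : Matrix (Fin p) (Fin p) ℂ → Module.End ℂ (κ → ℂ))
    (hS : ∀ P v, E (S P v) = P * E v * P.transpose) (k : ℕ) (χ : (Fin p → ℂ) → κ → ℂ)
    (hχ : ∀ d v, S (Matrix.diagonal d) v = χ d * v) (hk : ∀ d, ∏ x, χ d x = (∏ i, d i) ^ k) :
    IsEinsteinBase {z | (1 - E z * (E z).conjTranspose).PosDef} (fun z => detNorm (E z)) k := by
  refine isEinsteinBase_of_linear E hE k fun z hz => ?_
  have hd : 0 < detNorm (E z) := by
    have := hz.det_pos
    rw [det_one_sub_mul_conjTranspose] at this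
    exact_mod_cast this
  obtain ⟨P, hP⟩ := exists_conjTranspose_mul_self hz.inv.posSemidef
  have hB : 1 - (E z).conjTranspose * E z = (1 - E z * (E z).conjTranspose).transpose := by
    have h1 : (E z).conjTranspose.transpose = star ε • (E z).conjTranspose := by
      rw [← Matrix.conjTranspose_smul, ← hsymm]
      rfl
    rw [Matrix.transpose_sub, Matrix.transpose_one, Matrix.transpose_mul, hsymm, h1,
      Matrix.smul_mul, Matrix.mul_smul, smul_smul, hε, one_smul]
  refine ⟨P, P.transpose, S P, hP, ?_, hS P, ?_⟩
  · rw [hB, ← Matrix.transpose_nonsing_inv, hP, Matrix.transpose_mul]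
    rfl
  · rw [det_eq_det_pow_of_intertwining E hE (congruence p) S hS k χ hχ hk, norm_pow,
      pow_right_comm, norm_det_sq_of_inv_eq (det_one_sub_mul_conjTranspose _) hP, inv_pow,
      Real.rpow_neg hd.le, Real.rpow_natCast]

/-- `matII` as a linear map. -/
def linII (p : ℕ) : (IdxII p → ℂ) →ₗ[ℂ] Matrix (Fin p) (Fin p) ℂ where
  toFun := matII
  map_add' _ _ := rfl
  map_smul' _ _ := rfl

theorem linII_apply_of_le {p : ℕ} (v : IdxII p → ℂ) (x : IdxII p) :
    linII p v x.1.1 x.1.2 = v x := by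
  obtain ⟨⟨i, j⟩, h⟩ := x
  change matII v i j = _
  simp only [matII, Matrix.of_apply]
  congr 1
  exact Subtype.ext (Prod.ext (min_eq_left h) (max_eq_right h))

theorem linII_transpose {p : ℕ} (v : IdxII p → ℂ) : (linII p v).transpose = linII p v := by
  ext i j
  change matII v j i = matII v i j
  simp only [matII, Matrix.of_apply, min_comm, max_comm]

theorem linII_injective {p : ℕ} : Function.Injective (linII p) := fun v w h => by
  ext x
  rw [← linII_apply_of_le v, h, linII_apply_of_le]

/-- Coordinates of `P Z Pᵗ` for symmetric `Z`. -/
def actII {p : ℕ} (P : Matrix (Fin p) (Fin p) ℂ) : Module.End ℂ (IdxII p → ℂ) where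
  toFun v x := congruence p P (linII p v) x.1.1 x.1.2
  map_add' v w := by ext x; simp
  map_smul' c v := by ext x; simp

theorem linII_actII {p : ℕ} (P : Matrix (Fin p) (Fin p) ℂ) (v : IdxII p → ℂ) :
    linII p (actII P v) = P * linII p v * P.transpose := by
  have hs : (P * linII p v * P.transpose).transpose = P * linII p v * P.transpose := by
    simp [Matrix.transpose_mul, linII_transpose, Matrix.mul_assoc]
  have h1 : ∀ i j, i ≤ j → linII p (actII P v) i j = (P * linII p v * P.transpose) i j :=
    fun i j hij => linII_apply_of_le (actII P v) ⟨(i, j), hij⟩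
  ext i j
  rcases le_total i j with h | h
  · exact h1 i j h
  · rw [← linII_transpose, ← hs]
    exact h1 j i h

/-- Each index occurs `p + 1` times among the pairs `i ≤ j`, twice of them in the pair `(i, i)`. -/
theorem prod_le_mul {p : ℕ} (d : Fin p → ℂ) :
    ∏ x : IdxII p, d x.1.1 * d x.1.2 = (∏ i, d i) ^ (p + 1) := by
  have h : ∀ F : Fin p × Fin p → ℂ, ∏ x : IdxII p, F x.1 =
      ∏ i, ∏ j, if i ≤ j then F (i, j) else 1 := fun F => by
    rw [← Fintype.prod_prod_type' (f := fun i j => if i ≤ j then F (i, j) else 1),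
      ← Finset.prod_filter, Finset.prod_subtype (p := fun x : Fin p × Fin p => x.1 ≤ x.2)]
    simp
  rw [Finset.prod_mul_distrib, h fun x => d x.1, h fun x => d x.2,
    Finset.prod_comm (f := fun i j => if i ≤ j then d (i, j).2 else 1), ← Finset.prod_mul_distrib,
    ← Finset.prod_pow]
  refine Finset.prod_congr rfl fun i _ => ?_
  rw [← Finset.prod_mul_distrib, ← Finset.mul_prod_erase _ _ (Finset.mem_univ i)]
  rw [Finset.prod_congr rfl (g := fun _ => d i) fun j hj => ?_]
  · have hp : 1 ≤ p := i.pos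
    simp only [le_refl, if_true, Finset.prod_const, Finset.card_erase_of_mem (Finset.mem_univ i),
      Finset.card_univ, Fintype.card_fin]
    rw [← pow_two, ← pow_add]
    congr 1
    omega
  · rcases lt_or_gt_of_ne (Finset.ne_of_mem_erase hj) with h | h
    · simp [h.le, h.not_ge]
    · simp [h.le, h.not_ge]

theorem isEinsteinBase_RII (p : ℕ) :
    IsEinsteinBase (RII p) (fun z => detNorm (matII z)) (p + 1) := by
  have := isEinsteinBase_of_congruence (linII p) linII_injective 1 (by simp)
    (fun v => by rw [linII_transpose, one_smul]) actII linII_actII (p + 1)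
    (fun d x => d x.1.1 * d x.1.2) (fun d v => ?_) prod_le_mul
  · exact_mod_cast this
  · ext x
    simp only [actII, LinearMap.coe_mk, AddHom.coe_mk, congruence_apply,
      Matrix.diagonal_transpose, Matrix.mul_diagonal, Matrix.diagonal_mul, linII_apply_of_le,
      Pi.mul_apply]
    ring

/-- `matIII` as a linear map. -/
def linIII (q : ℕ) : (IdxIII q → ℂ) →ₗ[ℂ] Matrix (Fin q) (Fin q) ℂ where
  toFun := matIII
  map_add' v w := by
    ext i j
    simp only [matIII, Matrix.of_apply, Matrix.add_apply, Pi.add_apply]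
    split_ifs <;> ring
  map_smul' c v := by
    ext i j
    simp only [matIII, Matrix.of_apply, Matrix.smul_apply, Pi.smul_apply, RingHom.id_apply]
    split_ifs <;> simp

theorem linIII_apply_of_lt {q : ℕ} (v : IdxIII q → ℂ) (x : IdxIII q) :
    linIII q v x.1.1 x.1.2 = v x := by
  obtain ⟨⟨i, j⟩, h⟩ := x
  change matIII v i j = _
  simp only [matIII, Matrix.of_apply]
  exact dif_pos h

theorem linIII_transpose {q : ℕ} (v : IdxIII q → ℂ) : (linIII q v).transpose = -linIII q v := by
  ext i j
  change matIII v j i = -matIII v i j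
  simp only [matIII, Matrix.of_apply]
  rcases lt_trichotomy i j with h | h | h
  · simp [h, h.not_gt]
  · simp [h]
  · simp [h, h.not_gt]

theorem linIII_injective {q : ℕ} : Function.Injective (linIII q) := fun v w h => by
  ext x
  rw [← linIII_apply_of_lt v, h, linIII_apply_of_lt]

/-- Coordinates of `P Z Pᵗ` for skew-symmetric `Z`. -/
def actIII {q : ℕ} (P : Matrix (Fin q) (Fin q) ℂ) : Module.End ℂ (IdxIII q → ℂ) where
  toFun v x := congruence q P (linIII q v) x.1.1 x.1.2
  map_add' v w := by ext x; simp
  map_smul' c v := by ext x; simp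

theorem linIII_actIII {q : ℕ} (P : Matrix (Fin q) (Fin q) ℂ) (v : IdxIII q → ℂ) :
    linIII q (actIII P v) = P * linIII q v * P.transpose := by
  have hs : (P * linIII q v * P.transpose).transpose = -(P * linIII q v * P.transpose) := by
    simp [Matrix.transpose_mul, linIII_transpose, Matrix.mul_assoc]
  have h1 : ∀ i j, i < j → linIII q (actIII P v) i j = (P * linIII q v * P.transpose) i j :=
    fun i j hij => linIII_apply_of_lt (actIII P v) ⟨(i, j), hij⟩
  have h0 : ∀ M : Matrix (Fin q) (Fin q) ℂ, M.transpose = -M → ∀ i j, M i j = -M j i :=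
    fun M hM i j => congrFun (congrFun hM j) i
  ext i j
  rcases lt_trichotomy i j with h | h | h
  · exact h1 i j h
  · subst h
    rw [self_eq_neg.1 (h0 _ (linIII_transpose _) i i), self_eq_neg.1 (h0 _ hs i i)]
  · rw [h0 _ (linIII_transpose _) i j, h0 _ hs i j, h1 j i h]

/-- Each index occurs `q - 1` times among the pairs `i < j`. -/
theorem prod_lt_mul {q : ℕ} (d : Fin q → ℂ) :
    ∏ x : IdxIII q, d x.1.1 * d x.1.2 = (∏ i, d i) ^ (q - 1) := by
  have h : ∀ F : Fin q × Fin q → ℂ, ∏ x : IdxIII q, F x.1 =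
      ∏ i, ∏ j, if i < j then F (i, j) else 1 := fun F => by
    rw [← Fintype.prod_prod_type' (f := fun i j => if i < j then F (i, j) else 1),
      ← Finset.prod_filter, Finset.prod_subtype (p := fun x : Fin q × Fin q => x.1 < x.2)]
    simp
  rw [Finset.prod_mul_distrib, h fun x => d x.1, h fun x => d x.2,
    Finset.prod_comm (f := fun i j => if i < j then d (i, j).2 else 1), ← Finset.prod_mul_distrib,
    ← Finset.prod_pow]
  refine Finset.prod_congr rfl fun i _ => ?_
  rw [← Finset.prod_mul_distrib, ← Finset.mul_prod_erase _ _ (Finset.mem_univ i)]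
  rw [Finset.prod_congr rfl (g := fun _ => d i) fun j hj => ?_]
  · simp
  · rcases lt_or_gt_of_ne (Finset.ne_of_mem_erase hj) with h | h
    · simp [h, h.not_gt]
    · simp [h, h.not_gt]

theorem isEinsteinBase_RIII (q : ℕ) (hq : 1 ≤ q) :
    IsEinsteinBase (RIII q) (fun z => detNorm (matIII z)) (q - 1) := by
  have := isEinsteinBase_of_congruence (linIII q) linIII_injective (-1) (by simp)
    (fun v => by rw [linIII_transpose, neg_one_smul]) actIII linIII_actIII (q - 1)
    (fun d x => d x.1.1 * d x.1.2) (fun d v => ?_) prod_lt_mul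
  · rw [Nat.cast_sub hq, Nat.cast_one] at this
    exact this
  · ext x
    simp only [actIII, LinearMap.coe_mk, AddHom.coe_mk, congruence_apply,
      Matrix.diagonal_transpose, Matrix.mul_diagonal, Matrix.diagonal_mul, linIII_apply_of_lt,
      Pi.mul_apply]
    ring

end MatrixDomains

/-! ### The classical domain of type IV -/

section LieBall

variable {n : ℕ}

/-- The quadratic form `Z Zᵗ`. -/
def quad (z : Fin n → ℂ) : ℂ := ∑ i, z i ^ 2

/-- Half of the gradient `∂β`, that is `(Z̄ Z̄ᵗ) Z - Z̄`. -/
def halfGrad (z : Fin n → ℂ) : Fin n → ℂ := fun i => star (quad z) * z i - star (z i)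

theorem sum_star_mul_self (v : Fin n → ℂ) :
    ∑ i, star (v i) * v i = ((∑ i, ‖v i‖ ^ 2 : ℝ) : ℂ) := by
  push_cast
  exact Finset.sum_congr rfl fun i _ => by simpa using Complex.conj_mul' (v i)

theorem beta_eq (z : Fin n → ℂ) :
    beta z = 1 + ‖quad z‖ ^ 2 - 2 * ∑ i, ‖z i‖ ^ 2 := rfl

theorem ofReal_beta (z : Fin n → ℂ) :
    (beta z : ℂ) = 1 + star (quad z) * quad z - 2 * ∑ i, star (z i) * z i := by
  rw [beta_eq, sum_star_mul_self]
  push_cast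
  congr 2
  simpa using (Complex.conj_mul' (quad z)).symm

theorem contDiff_coord {k : WithTop ℕ∞} (i : Fin n) : ContDiff ℝ k fun w : Fin n → ℂ => w i :=
  contDiff_apply ℝ ℂ i

theorem contDiff_quad {k : WithTop ℕ∞} : ContDiff ℝ k (quad : (Fin n → ℂ) → ℂ) :=
  ContDiff.sum fun i _ => (contDiff_coord i).pow 2

theorem contDiff_beta {k : WithTop ℕ∞} : ContDiff ℝ k (beta : (Fin n → ℂ) → ℝ) :=
  (contDiff_const.add (contDiff_quad.norm_sq ℝ)).sub
    (contDiff_const.mul (ContDiff.sum fun i _ => (contDiff_coord i).norm_sq ℝ))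

theorem differentiable_star_coord (i : Fin n) :
    Differentiable ℝ fun w : Fin n → ℂ => star (w i) :=
  (Complex.conjCLE : ℂ →L[ℝ] ℂ).differentiable.comp ((contDiff_coord i).differentiable one_ne_zero)

variable {z : Fin n → ℂ}

theorem diffAt_coord (i : Fin n) : DifferentiableAt ℝ (fun w : Fin n → ℂ => w i) z :=
  (contDiff_coord i).differentiable one_ne_zero z

theorem diffAt_quad : DifferentiableAt ℝ (quad : (Fin n → ℂ) → ℂ) z :=
  contDiff_quad.differentiable one_ne_zero z

theorem diffAt_star_quad : DifferentiableAt ℝ (fun w : Fin n → ℂ => star (quad w)) z :=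
  (Complex.conjCLE : ℂ →L[ℝ] ℂ).differentiableAt.comp z diffAt_quad

theorem wd_quad (c : ℂ) (i : Fin n) :
    wd c i quad z = 2 * ∑ k, z k * wd c i (fun w => w k) z := by
  unfold quad
  rw [wd_sum _ (fun k w => w k ^ 2) fun k _ => (diffAt_coord k).pow 2, Finset.mul_sum]
  refine Finset.sum_congr rfl fun k _ => ?_
  simp only [pow_two]
  rw [wd_mul (diffAt_coord k) (diffAt_coord k)]
  ring

theorem dz_quad (i : Fin n) : dz i quad z = 2 * z i := by
  rw [dz_eq_wd, wd_quad]
  simp only [← dz_eq_wd, dz_coord]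
  simp

theorem dzbar_quad (j : Fin n) : dzbar j quad z = 0 := by
  rw [dzbar_eq_wd, wd_quad]
  simp only [← dzbar_eq_wd, dzbar_coord]
  simp

theorem dzbar_beta (j : Fin n) :
    dzbar j (fun w => (beta w : ℂ)) z = 2 * (quad z * star (z j) - z j) := by
  have h1 : dzbar j (fun w : Fin n → ℂ => star (quad w)) z = 2 * star (z j) := by
    rw [dzbar_star diffAt_quad, dz_quad]
    simp
  have h2 : ∀ k, dzbar j (fun w : Fin n → ℂ => star (w k)) z = if j = k then 1 else 0 := by
    intro k
    rw [dzbar_star (diffAt_coord k), dz_coord]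
    split_ifs <;> simp
  have hd : ∀ k, DifferentiableAt ℝ (fun w : Fin n → ℂ => star (w k) * w k) z := fun k =>
    (differentiable_star_coord k z).mul (diffAt_coord k)
  have hds : DifferentiableAt ℝ (fun w : Fin n → ℂ => ∑ k, star (w k) * w k) z :=
    DifferentiableAt.fun_sum fun k _ => hd k
  have hdq : DifferentiableAt ℝ (fun w : Fin n → ℂ => star (quad w) * quad w) z :=
    diffAt_star_quad.mul diffAt_quad
  have hda : DifferentiableAt ℝ (fun w : Fin n → ℂ => 1 + star (quad w) * quad w) z :=
    (differentiableAt_const _).add hdq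
  simp only [ofReal_beta]
  rw [dzbar_eq_wd, wd_sub hda (hds.const_mul _),
    wd_add (differentiableAt_const _) hdq, wd_const, wd_mul diffAt_star_quad diffAt_quad,
    wd_const_mul _ hds, wd_sum _ _ fun k _ => hd k,
    Finset.sum_congr rfl fun k _ => wd_mul (differentiable_star_coord k z) (diffAt_coord k)]
  simp only [← dzbar_eq_wd, dzbar_quad, h1, h2, dzbar_coord]
  simp
  ring

theorem dz_beta (i : Fin n) : dz i (fun w => (beta w : ℂ)) z = 2 * halfGrad z i := by
  rw [dz_ofReal (contDiff_beta.differentiable one_ne_zero z), dzbar_beta]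
  simp [halfGrad]

theorem complexHessian_beta (i j : Fin n) :
    complexHessian beta z i j = 4 * (z i * star (z j)) - 2 * if i = j then 1 else 0 := by
  have hs : dz i (fun w : Fin n → ℂ => star (w j)) z = 0 := by
    rw [dz_star (diffAt_coord j), dzbar_coord, star_zero]
  have hm : DifferentiableAt ℝ (fun w : Fin n → ℂ => quad w * star (w j)) z :=
    diffAt_quad.mul (differentiable_star_coord j z)
  have hs' : DifferentiableAt ℝ (fun w : Fin n → ℂ => quad w * star (w j) - w j) z :=
    hm.sub (diffAt_coord j)
  rw [complexHessian_apply_congr (Filter.Eventually.of_forall fun w => dzbar_beta j), dz_eq_wd,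
    wd_const_mul _ hs', wd_sub hm (diffAt_coord j),
    wd_mul diffAt_quad (differentiable_star_coord j z)]
  simp only [← dz_eq_wd, dz_quad, dz_coord, hs]
  ring

/-- The matrix `1 - 2 Zᵗ Z̄ + c wᵗ w̄`, `w = halfGrad Z`, as a perturbation of `1` of rank two. -/
def rankTwo (c : ℂ) (z : Fin n → ℂ) : Matrix (Fin n) (Fin n) ℂ :=
  1 + (Matrix.of fun i (k : Fin 2) => ![-2 * z i, c * halfGrad z i] k) *
    (Matrix.of fun (k : Fin 2) j => ![star (z j), star (halfGrad z j)] k)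

theorem complexHessian_neg_log_beta (h : beta z ≠ 0) :
    complexHessian (fun w => -Real.log (beta w)) z =
      ((2 / beta z : ℝ) : ℂ) • rankTwo ((2 / beta z : ℝ) : ℂ) z := by
  have h' : (beta z : ℂ) ≠ 0 := by exact_mod_cast h
  have h2 : HasDerivAt (fun x : ℝ => -x⁻¹) (-(-(beta z ^ 2)⁻¹)) (beta z) := (hasDerivAt_inv h).neg
  rw [complexHessian_comp (F := fun x => -Real.log x) (F' := fun x => -x⁻¹)
    contDiff_beta.contDiffAt _ h2]
  · ext i j
    simp only [Matrix.add_apply, Matrix.smul_apply, Matrix.of_apply, complexHessian_beta, dz_beta,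
      dzbar_beta, smul_eq_mul, rankTwo, Matrix.mul_apply, Fin.sum_univ_two, Matrix.one_apply]
    have h3 : star (halfGrad z j) = quad z * star (z j) - z j := by simp [halfGrad]
    rw [← h3]
    by_cases hij : i = j
    · simp [hij]
      field_simp
      ring
    · simp [hij]
      field_simp
      ring
  · filter_upwards [eventually_ne_nhds h] with x hx
    exact (Real.hasDerivAt_log hx).neg

theorem sum_star_mul_halfGrad :
    ∑ i, star (z i) * halfGrad z i =
      star (quad z) * ((∑ i, ‖z i‖ ^ 2 : ℝ) : ℂ) - star (quad z) := by
  have hq : star (quad z) = ∑ i, star (z i ^ 2) := by rw [quad, star_sum]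
  conv_rhs => enter [2]; rw [hq]
  rw [← sum_star_mul_self, Finset.mul_sum, ← Finset.sum_sub_distrib]
  refine Finset.sum_congr rfl fun i _ => ?_
  simp only [halfGrad, star_pow]
  ring

theorem sum_star_halfGrad_mul :
    ∑ i, star (halfGrad z i) * z i = quad z * ((∑ i, ‖z i‖ ^ 2 : ℝ) : ℂ) - quad z := by
  have := congrArg star (sum_star_mul_halfGrad (z := z))
  simpa [star_sum, mul_comm] using this

theorem sum_norm_halfGrad_sq :
    ∑ i, ‖halfGrad z i‖ ^ 2 =
      ‖quad z‖ ^ 2 * ∑ i, ‖z i‖ ^ 2 - 2 * ‖quad z‖ ^ 2 + ∑ i, ‖z i‖ ^ 2 := by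
  have hq : star (quad z) * quad z = ((‖quad z‖ ^ 2 : ℝ) : ℂ) := by
    simpa using Complex.conj_mul' (quad z)
  have h1 : ∑ i, star (halfGrad z i) * halfGrad z i =
      star (quad z) * ∑ i, star (halfGrad z i) * z i - quad z * star (quad z) +
        ∑ i, star (z i) * z i := by
    conv_rhs => enter [1, 2, 2]; rw [quad, star_sum]
    rw [Finset.mul_sum, Finset.mul_sum, ← Finset.sum_sub_distrib, ← Finset.sum_add_distrib]
    refine Finset.sum_congr rfl fun i _ => ?_
    simp only [halfGrad, star_pow, star_sub, star_mul', star_star]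
    ring
  rw [sum_star_halfGrad_mul, sum_star_mul_self, sum_star_mul_self, mul_sub, ← mul_assoc,
    mul_comm (quad z) (star (quad z)), hq] at h1
  have h2 : (∑ i, ‖halfGrad z i‖ ^ 2 : ℝ) = ‖quad z‖ ^ 2 * (∑ i, ‖z i‖ ^ 2) - ‖quad z‖ ^ 2
      - ‖quad z‖ ^ 2 + ∑ i, ‖z i‖ ^ 2 := by exact_mod_cast h1
  rw [h2]
  ring

/-- By the Weinstein–Aronszajn identity this is a `2 × 2` determinant in the quantities `|Z|²` and
`|Z Zᵗ|²`; it equals `β / β`. -/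
theorem det_rankTwo (h : beta z ≠ 0) : (rankTwo ((2 / beta z : ℝ) : ℂ) z).det = 1 := by
  have hq : quad z * star (quad z) = ((‖quad z‖ ^ 2 : ℝ) : ℂ) := by
    simpa using Complex.mul_conj' (quad z)
  rw [rankTwo, Matrix.det_one_add_mul_comm, Matrix.det_fin_two]
  simp only [Matrix.add_apply, Matrix.mul_apply, Matrix.of_apply, Matrix.one_apply]
  have e00 : ∑ j, star (z j) * (-2 * z j) = -2 * ((∑ i, ‖z i‖ ^ 2 : ℝ) : ℂ) := by
    rw [← sum_star_mul_self, Finset.mul_sum]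
    exact Finset.sum_congr rfl fun _ _ => by ring
  have e01 (c : ℂ) : ∑ j, star (z j) * (c * halfGrad z j) =
      c * (star (quad z) * ((∑ i, ‖z i‖ ^ 2 : ℝ) : ℂ) - star (quad z)) := by
    rw [← sum_star_mul_halfGrad, Finset.mul_sum]
    exact Finset.sum_congr rfl fun _ _ => by ring
  have e10 : ∑ j, star (halfGrad z j) * (-2 * z j) =
      -2 * (quad z * ((∑ i, ‖z i‖ ^ 2 : ℝ) : ℂ) - quad z) := by
    rw [← sum_star_halfGrad_mul, Finset.mul_sum]
    exact Finset.sum_congr rfl fun _ _ => by ring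
  have e11 (c : ℂ) : ∑ j, star (halfGrad z j) * (c * halfGrad z j) =
      c * ((∑ i, ‖halfGrad z i‖ ^ 2 : ℝ) : ℂ) := by
    rw [← sum_star_mul_self, Finset.mul_sum]
    exact Finset.sum_congr rfl fun _ _ => by ring
  simp only [Matrix.cons_val_zero, Matrix.cons_val_one, e00, e01, e10, e11, if_true,
    Fin.zero_eq_one_iff, Fin.one_eq_zero_iff, OfNat.ofNat_ne_one, if_false, zero_add]
  rw [sum_norm_halfGrad_sq]
  have hb := beta_eq z
  set r : ℝ := ∑ i, ‖z i‖ ^ 2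
  set s : ℝ := ‖quad z‖ ^ 2
  have e : ((2 / beta z : ℝ) : ℂ) * (star (quad z) * (r : ℂ) - star (quad z)) *
      (-2 * (quad z * (r : ℂ) - quad z)) = ((2 / beta z * (-2) * s * (r - 1) ^ 2 : ℝ) : ℂ) := by
    push_cast [← hq]
    ring
  rw [e]
  have key : (1 + -2 * r) * (1 + 2 / beta z * (s * r - 2 * s + r)) -
      2 / beta z * (-2) * s * (r - 1) ^ 2 = 1 := by
    field_simp
    rw [hb]
    ring
  have := congrArg Complex.ofReal key
  push_cast at this ⊢
  exact this

theorem norm_sum_star_mul_sq_le (u v : Fin n → ℂ) :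
    ‖∑ i, star (u i) * v i‖ ^ 2 ≤ (∑ i, ‖u i‖ ^ 2) * ∑ i, ‖v i‖ ^ 2 := by
  have h : ‖∑ i, star (u i) * v i‖ ≤ ∑ i, ‖u i‖ * ‖v i‖ :=
    (norm_sum_le _ _).trans_eq (by simp)
  exact (pow_le_pow_left₀ (norm_nonneg _) h 2).trans (Finset.sum_mul_sq_le_sq_mul_sq _ _ _)

theorem star_dotProduct_rankTwo (c : ℝ) (v : Fin n → ℂ) :
    star v ⬝ᵥ (rankTwo (c : ℂ) z).mulVec v = ((∑ i, ‖v i‖ ^ 2 -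
      2 * ‖∑ i, star (z i) * v i‖ ^ 2 + c * ‖∑ i, star (halfGrad z i) * v i‖ ^ 2 : ℝ) : ℂ) := by
  have h : ∀ i, (rankTwo (c : ℂ) z).mulVec v i = v i - 2 * z i * ∑ j, star (z j) * v j +
      c * halfGrad z i * ∑ j, star (halfGrad z j) * v j := by
    intro i
    rw [rankTwo, Matrix.add_mulVec, Matrix.one_mulVec, ← Matrix.mulVec_mulVec]
    simp only [Pi.add_apply, Matrix.mulVec, dotProduct, Fin.sum_univ_two, Matrix.of_apply,
      Matrix.cons_val_zero, Matrix.cons_val_one]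
    ring
  have hsq : ∀ a : ℂ, star a * a = ((‖a‖ ^ 2 : ℝ) : ℂ) := fun a => by
    simpa using Complex.conj_mul' a
  have hst : ∀ u : Fin n → ℂ, ∑ i, star (v i) * u i = star (∑ i, star (u i) * v i) := fun u => by
    simp [star_sum, mul_comm]
  have h2 : ∀ a b : ℂ, ∑ i, star (v i) * (v i - 2 * z i * a + c * halfGrad z i * b) =
      ∑ i, star (v i) * v i - 2 * ((∑ i, star (v i) * z i) * a) +
        c * ((∑ i, star (v i) * halfGrad z i) * b) := fun a b => by
    simp only [Finset.sum_mul, Finset.mul_sum, ← Finset.sum_add_distrib, ← Finset.sum_sub_distrib]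
    exact Finset.sum_congr rfl fun i _ => by ring
  simp only [dotProduct, h, Pi.star_apply]
  rw [h2, hst z, hst (halfGrad z), hsq, hsq, sum_star_mul_self]
  push_cast
  rfl

/-- Where `β > 0` the negative term of `star_dotProduct_rankTwo` is dominated: for
`t = -τ Z Zᵗ` one has `Z = (Z - t w) + t w`, and the Cauchy–Schwarz inequality for the form
`|v|² + c |w̄ · v|²`, `c = 2 / β`, reduces the claim to `|Z - t w|² + |t|² / c < 1 / 2`. The optimal
`τ` makes the left-hand side equal to `1 / 2 - β / (2 Δ)`, where `Δ = β + 2 |w|²`. -/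
theorem posDef_rankTwo (h : 0 < beta z) : (rankTwo ((2 / beta z : ℝ) : ℂ) z).PosDef := by
  refine Matrix.PosDef.of_dotProduct_mulVec_pos ?_ fun v hv => ?_
  · ext i j
    simp only [rankTwo, Matrix.conjTranspose_apply, Matrix.add_apply, Matrix.mul_apply,
      Fin.sum_univ_two, Matrix.of_apply, Matrix.one_apply]
    by_cases hij : i = j
    · subst hij
      simp
      ring
    · simp [hij, Ne.symm hij]
      ring
  rw [star_dotProduct_rankTwo, Complex.zero_lt_real]
  set r : ℝ := ∑ i, ‖z i‖ ^ 2 with hr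
  set s : ℝ := ‖quad z‖ ^ 2 with hs
  set a := ∑ i, star (z i) * v i with ha
  set b := ∑ i, star (halfGrad z i) * v i with hb
  have hβ : beta z = 1 + s - 2 * r := beta_eq z
  set W : ℝ := ∑ i, ‖halfGrad z i‖ ^ 2 with hW
  have hWeq : W = s * r - 2 * s + r := sum_norm_halfGrad_sq
  have hW0 : 0 ≤ W := Finset.sum_nonneg fun i _ => by positivity
  have hv0 : 0 < ∑ i, ‖v i‖ ^ 2 := by
    obtain ⟨k, hk⟩ := Function.ne_iff.1 hv
    exact Finset.sum_pos' (fun i _ => by positivity)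
      ⟨k, Finset.mem_univ k, by have := norm_pos_iff.2 hk; positivity⟩
  set Δ : ℝ := beta z + 2 * W with hΔ
  have hΔ0 : 0 < Δ := by positivity
  set τ : ℝ := 2 * (1 - r) / Δ with hτ
  set t : ℂ := -τ * quad z with ht
  have hu : ∑ i, ‖z i - t * halfGrad z i‖ ^ 2 = r + 2 * τ * (s * r - s) + τ ^ 2 * s * W := by
    have h1 : ((∑ i, ‖z i - t * halfGrad z i‖ ^ 2 : ℝ) : ℂ) = ∑ i, star (z i) * z i
        - t * ∑ i, star (z i) * halfGrad z i - star t * ∑ i, star (halfGrad z i) * z i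
        + star t * t * ∑ i, star (halfGrad z i) * halfGrad z i := by
      rw [← sum_star_mul_self]
      simp only [Finset.mul_sum, ← Finset.sum_add_distrib, ← Finset.sum_sub_distrib]
      refine Finset.sum_congr rfl fun i _ => ?_
      simp only [star_sub, star_mul']
      ring
    have hq : star (quad z) * quad z = ((s : ℝ) : ℂ) := by
      rw [hs]
      simpa using Complex.conj_mul' (quad z)
    rw [sum_star_mul_self, sum_star_mul_self, sum_star_mul_halfGrad, sum_star_halfGrad_mul,
      ← hr, ← hW] at h1
    have h2 : star t = -τ * star (quad z) := by simp [ht]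
    have h3 : ((∑ i, ‖z i - t * halfGrad z i‖ ^ 2 : ℝ) : ℂ) =
        ((r + 2 * τ * (s * r - s) + τ ^ 2 * s * W : ℝ) : ℂ) := by
      rw [h1, h2, ht]
      push_cast [← hq]
      ring
    exact_mod_cast h3
  have ht2 : ‖t‖ ^ 2 = τ ^ 2 * s := by
    rw [ht, norm_mul, mul_pow, norm_neg, Complex.norm_real, Real.norm_eq_abs, sq_abs]
  have hsplit : a = ∑ i, star (z i - t * halfGrad z i) * v i + star t * b := by
    rw [ha, hb, Finset.mul_sum, ← Finset.sum_add_distrib]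
    refine Finset.sum_congr rfl fun i _ => ?_
    simp only [star_sub, star_mul']
    ring
  set p := ∑ i, star (z i - t * halfGrad z i) * v i with hp
  have hCS : ‖p‖ ^ 2 ≤ (∑ i, ‖z i - t * halfGrad z i‖ ^ 2) * ∑ i, ‖v i‖ ^ 2 :=
    norm_sum_star_mul_sq_le _ _
  set U : ℝ := ∑ i, ‖z i - t * halfGrad z i‖ ^ 2 with hU
  set V : ℝ := ∑ i, ‖v i‖ ^ 2 with hV
  have hU0 : 0 ≤ U := Finset.sum_nonneg fun i _ => by positivity
  have hval : U + beta z / 2 * (τ ^ 2 * s) = 1 / 2 - beta z / (2 * Δ) := by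
    have h1 : U + beta z / 2 * (τ ^ 2 * s) = r - 2 * s * (1 - r) * τ + τ ^ 2 * s * Δ / 2 := by
      rw [hu, hΔ]
      ring
    have hΔ' : Δ = 1 - 3 * s + 2 * s * r := by
      rw [hΔ, hWeq, hβ]
      ring
    -- `(1 - 2 r) Δ + 4 s (1 - r)² = β`
    rw [h1, hτ]
    field_simp
    rw [hβ, hΔ']
    ring
  have htri : ‖a‖ ≤ ‖p‖ + ‖t‖ * ‖b‖ := by
    rw [hsplit]
    refine (norm_add_le _ _).trans_eq ?_
    rw [norm_mul, norm_star]
  have hmain : ‖a‖ ^ 2 ≤ (U + beta z / 2 * ‖t‖ ^ 2) * (V + 2 / beta z * ‖b‖ ^ 2) := by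
    have hP : ‖p‖ ≤ √U * √V := by
      rw [← Real.sqrt_mul hU0]
      exact Real.le_sqrt_of_sq_le hCS
    have h1 : ‖a‖ ^ 2 ≤ (√U * √V + ‖t‖ * ‖b‖) ^ 2 :=
      pow_le_pow_left₀ (norm_nonneg _) (htri.trans (by gcongr)) 2
    have h2 : ∀ x y B C k : ℝ, 0 < k → (x ^ 2 + k / 2 * C ^ 2) * (y ^ 2 + 2 / k * B ^ 2) -
        (x * y + C * B) ^ 2 = 2 / k * (x * B - k / 2 * (C * y)) ^ 2 := by
      intro x y B C k hk
      field_simp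
      ring
    have h2 := h2 (√U) (√V) ‖b‖ ‖t‖ (beta z) h
    rw [Real.sq_sqrt hU0, Real.sq_sqrt hv0.le] at h2
    have h3 : 0 ≤ 2 / beta z * (√U * ‖b‖ - beta z / 2 * (‖t‖ * √V)) ^ 2 := by positivity
    linarith
  rw [ht2, hval] at hmain
  have hpos : 0 < V + 2 / beta z * ‖b‖ ^ 2 := by positivity
  have hgap : 0 < beta z / (2 * Δ) := by positivity
  nlinarith [mul_pos hgap hpos]

theorem isEinsteinBase_RIV (n : ℕ) : IsEinsteinBase (RIV n) beta n := by
  have hq : Continuous (quad : (Fin n → ℂ) → ℂ) := (contDiff_quad (k := 0)).continuous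
  have hβ : Continuous (beta : (Fin n → ℂ) → ℝ) := (contDiff_beta (k := 0)).continuous
  refine ⟨(isOpen_lt continuous_const hβ).inter
    (isOpen_lt continuous_const (continuous_const.sub (hq.norm.pow 2))), fun z hz => hz.1,
    fun z _ => contDiff_beta.contDiffAt, fun z hz => ?_, 2 ^ n, by positivity, fun z hz => ?_⟩
  · rw [complexHessian_neg_log_beta hz.1.ne']
    refine (posDef_rankTwo hz.1).smul ?_
    rw [Complex.zero_lt_real]
    exact div_pos two_pos hz.1
  · rw [complexHessian_neg_log_beta hz.1.ne', Matrix.det_smul, det_rankTwo hz.1.ne', mul_one,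
      Fintype.card_fin, Real.rpow_neg hz.1.le, Real.rpow_natCast, ← Complex.ofReal_pow, div_pow,
      div_eq_mul_inv]

end LieBall

/-! ### Hermitian forms and derivatives on the product of base and fibre -/

section HermForm

variable {κ : Type*} [Fintype κ] [DecidableEq κ]

theorem hermForm_add (A B : Matrix κ κ ℂ) (v : κ → ℂ) :
    hermForm (A + B) v = hermForm A v + hermForm B v := by
  simp only [hermForm, Matrix.add_apply, mul_add, add_mul, Finset.sum_add_distrib, Complex.add_re]

theorem hermForm_smul (c : ℝ) (A : Matrix κ κ ℂ) (v : κ → ℂ) :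
    hermForm ((c : ℂ) • A) v = c * hermForm A v := by
  simp only [hermForm, Matrix.smul_apply, smul_eq_mul]
  rw [← Complex.re_ofReal_mul, Finset.mul_sum]
  simp only [Finset.mul_sum]
  congr 1
  exact Finset.sum_congr rfl fun i _ => Finset.sum_congr rfl fun j _ => by ring

theorem hermForm_eq_dotProduct (A : Matrix κ κ ℂ) (v : κ → ℂ) :
    hermForm A v = (star (star v) ⬝ᵥ A.mulVec (star v)).re := by
  simp only [hermForm, dotProduct, Matrix.mulVec, Finset.mul_sum, star_star, Pi.star_apply,
    mul_assoc]

theorem posDef_of_hermForm_pos {A : Matrix κ κ ℂ} (hA : A.IsHermitian)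
    (h : ∀ v, v ≠ 0 → 0 < hermForm A v) : A.PosDef := by
  refine Matrix.PosDef.of_dotProduct_mulVec_pos hA fun v hv => ?_
  have h1 := h (star v) (by simpa using hv)
  simp only [hermForm_eq_dotProduct, star_star] at h1
  rw [Complex.lt_def]
  exact ⟨h1, (hA.im_star_dotProduct_mulVec_self v).symm⟩

theorem hermForm_pos {A : Matrix κ κ ℂ} (hA : A.PosDef) {v : κ → ℂ} (hv : v ≠ 0) :
    0 < hermForm A v := by
  rw [hermForm_eq_dotProduct]
  exact (Complex.lt_def.1 (hA.dotProduct_mulVec_pos (by simpa using hv))).1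

theorem hermForm_nonneg {A : Matrix κ κ ℂ} (hA : A.PosDef) (v : κ → ℂ) : 0 ≤ hermForm A v := by
  by_cases hv : v = 0
  · subst hv; simp [hermForm]
  · exact (hermForm_pos hA hv).le

theorem hermForm_rankOne (L v : κ → ℂ) :
    hermForm (Matrix.of fun a b => L a * star (L b)) v = ‖∑ a, v a * L a‖ ^ 2 := by
  have h : ∑ i, ∑ j, v i * (L i * star (L j)) * star (v j) =
      (∑ a, v a * L a) * star (∑ a, v a * L a) := by
    rw [star_sum, Finset.sum_mul_sum]
    refine Finset.sum_congr rfl fun i _ => Finset.sum_congr rfl fun j _ => ?_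
    rw [star_mul']
    ring
  have h2 : (∑ a, v a * L a) * star (∑ a, v a * L a) = ((‖∑ a, v a * L a‖ ^ 2 : ℝ) : ℂ) := by
    simpa using Complex.mul_conj' (∑ a, v a * L a)
  simp only [hermForm, Matrix.of_apply]
  rw [h, h2, Complex.ofReal_re]

theorem hermForm_sum {α : Type*} (s : Finset α) (A : α → Matrix κ κ ℂ) (v : κ → ℂ) :
    hermForm (∑ k ∈ s, A k) v = ∑ k ∈ s, hermForm (A k) v := by
  classical
  induction s using Finset.induction_on with
  | empty => simp [hermForm]
  | insert a s ha ih => rw [Finset.sum_insert ha, Finset.sum_insert ha, hermForm_add, ih]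

end HermForm

section HartogsCalculus

variable {ι : Type*} [Fintype ι] [DecidableEq ι] {N : ℕ}

/-- The Hessian of `φ` on the base, as a form on the product. -/
def liftBase (N : ℕ) (Φ : Matrix ι ι ℂ) : Matrix (ι ⊕ Fin N) (ι ⊕ Fin N) ℂ :=
  Matrix.fromBlocks Φ 0 0 0

/-- The coefficient of the coordinate differential `a` in the one-form `θ_k = dW_k + W_k η`. -/
def theta (η : ι → ℂ) (W : Fin N → ℂ) : Matrix (ι ⊕ Fin N) (Fin N) ℂ :=
  Matrix.of fun a k => Sum.elim (fun i => W k * η i) (fun l => if l = k then 1 else 0) a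

/-- The coefficients of the one-form `∑ W̄_k θ_k`. -/
def radial (η : ι → ℂ) (W : Fin N → ℂ) : ι ⊕ Fin N → ℂ :=
  fun a => ∑ k, star (W k) * theta η W a k

/-- The Hermitian form `α Φ + β ∑ |θ_k|² + γ |∑ W̄_k θ_k|²` on the product. -/
def adaptedForm (Φ : Matrix ι ι ℂ) (η : ι → ℂ) (W : Fin N → ℂ) (α β γ : ℝ) :
    Matrix (ι ⊕ Fin N) (ι ⊕ Fin N) ℂ :=
  (α : ℂ) • liftBase N Φ +
    (β : ℂ) • (∑ k, Matrix.of fun a b => theta η W a k * star (theta η W b k)) +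
    (γ : ℂ) • Matrix.of fun a b => radial η W a * star (radial η W b)

variable {Φ : Matrix ι ι ℂ} {η : ι → ℂ} {W : Fin N → ℂ}

theorem hermForm_liftBase (v : ι ⊕ Fin N → ℂ) :
    hermForm (liftBase N Φ) v = hermForm Φ fun i => v (Sum.inl i) := by
  simp [hermForm, liftBase, Fintype.sum_sum_type]

theorem hermForm_adaptedForm (α β γ : ℝ) (v : ι ⊕ Fin N → ℂ) :
    hermForm (adaptedForm Φ η W α β γ) v = α * hermForm Φ (fun i => v (Sum.inl i)) +
      β * ∑ k, ‖∑ a, v a * theta η W a k‖ ^ 2 + γ * ‖∑ a, v a * radial η W a‖ ^ 2 := by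
  simp only [adaptedForm, hermForm_add, hermForm_smul, hermForm_sum, hermForm_liftBase]
  congr 2
  · congr 1
    exact Finset.sum_congr rfl fun k _ => hermForm_rankOne (fun a => theta η W a k) v
  · exact hermForm_rankOne (radial η W) v

/-- Cauchy–Schwarz: `|∑ W̄_k θ_k|² ≤ |W|² ∑ |θ_k|²`. -/
theorem norm_sum_radial_sq_le (v : ι ⊕ Fin N → ℂ) :
    ‖∑ a, v a * radial η W a‖ ^ 2 ≤
      (∑ k, ‖W k‖ ^ 2) * ∑ k, ‖∑ a, v a * theta η W a k‖ ^ 2 := by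
  have h : ∑ a, v a * radial η W a = ∑ k, star (W k) * ∑ a, v a * theta η W a k := by
    simp only [radial, Finset.mul_sum]
    rw [Finset.sum_comm]
    exact Finset.sum_congr rfl fun k _ => Finset.sum_congr rfl fun a _ => by ring
  rw [h]
  exact norm_sum_star_mul_sq_le _ _

theorem isHermitian_adaptedForm (hΦ : Φ.IsHermitian) (α β γ : ℝ) :
    (adaptedForm Φ η W α β γ).IsHermitian := by
  ext a b
  have h1 : star (liftBase N Φ b a) = liftBase N Φ a b := by
    rcases a with i | k <;> rcases b with j | l <;> simp [liftBase]
    exact hΦ.apply i j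
  simp only [adaptedForm, Matrix.conjTranspose_apply, Matrix.add_apply, Matrix.smul_apply,
    Matrix.sum_apply, Matrix.of_apply, smul_eq_mul, star_add, star_mul', star_sum, h1, star_star]
  simp [mul_comm]

theorem posDef_adaptedForm (hΦ : Φ.PosDef) {α β γ : ℝ} (hα : 0 < α) (hβ : 0 < β) (hγ : 0 ≤ γ) :
    (adaptedForm Φ η W α β γ).PosDef := by
  refine posDef_of_hermForm_pos (isHermitian_adaptedForm hΦ.isHermitian _ _ _) fun v hv => ?_
  rw [hermForm_adaptedForm]
  have h3 : 0 ≤ γ * ‖∑ a, v a * radial η W a‖ ^ 2 := by positivity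
  have h2 : 0 ≤ ∑ k, ‖∑ a, v a * theta η W a k‖ ^ 2 :=
    Finset.sum_nonneg fun k _ => by positivity
  by_cases hb : (fun i => v (Sum.inl i)) = 0
  · have hb' : ∀ i, v (Sum.inl i) = 0 := fun i => congrFun hb i
    have hth : ∀ k, ∑ a, v a * theta η W a k = v (Sum.inr k) := fun k => by
      simp [Fintype.sum_sum_type, hb', theta]
    have h2' : 0 < ∑ k, ‖∑ a, v a * theta η W a k‖ ^ 2 := by
      simp only [hth]
      obtain ⟨k, hk⟩ : ∃ k, v (Sum.inr k) ≠ 0 := by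
        by_contra! hall
        exact hv (funext fun a => by rcases a with i | k; exacts [hb' i, hall k])
      exact Finset.sum_pos' (fun i _ => by positivity)
        ⟨k, Finset.mem_univ k, by have := norm_pos_iff.2 hk; positivity⟩
    have := hermForm_nonneg hΦ fun i => v (Sum.inl i)
    positivity
  · have := hermForm_pos hΦ hb
    positivity

/-- In the coframe `dz_i, θ_k`, which is a unimodular change of the coordinate coframe, the adapted
form is block diagonal. -/
theorem det_adaptedForm (α β γ : ℝ) (hβ : β ≠ 0) :
    (adaptedForm Φ η W α β γ).det = (α : ℂ) ^ Fintype.card ι * Φ.det *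
      ((β ^ N * (1 + γ / β * ∑ k, ‖W k‖ ^ 2) : ℝ) : ℂ) := by
  -- the coefficients of `β ∑ |θ_k|² + γ |∑ W̄_k θ_k|²` with respect to the forms `θ_k`
  set B : Matrix (Fin N) (Fin N) ℂ := (β : ℂ) • (1 +
    Matrix.replicateCol Unit (fun k => star (W k)) *
    Matrix.replicateRow Unit (fun k => ((γ / β : ℝ) : ℂ) * W k)) with hB
  set J : Matrix (ι ⊕ Fin N) (ι ⊕ Fin N) ℂ :=
    Matrix.fromBlocks 1 (Matrix.of fun i k => W k * η i) 0 1 with hJ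
  have hβ' : (β : ℂ) ≠ 0 := by exact_mod_cast hβ
  have hJdet : J.det = 1 := by rw [hJ, Matrix.det_fromBlocks_zero₂₁]; simp
  have hBdet : B.det = ((β ^ N * (1 + γ / β * ∑ k, ‖W k‖ ^ 2) : ℝ) : ℂ) := by
    have h1 : (fun k => ((γ / β : ℝ) : ℂ) * W k) ⬝ᵥ (fun k => star (W k)) =
        ((γ / β * ∑ k, ‖W k‖ ^ 2 : ℝ) : ℂ) := by
      rw [Complex.ofReal_mul, ← sum_star_mul_self, Finset.mul_sum, dotProduct]
      exact Finset.sum_congr rfl fun k _ => by ring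
    rw [hB, Matrix.det_smul, Matrix.det_one_add_replicateCol_mul_replicateRow, h1,
      Fintype.card_fin]
    push_cast
    ring
  have hfac : adaptedForm Φ η W α β γ =
      J * Matrix.fromBlocks ((α : ℂ) • Φ) 0 0 B * J.conjTranspose := by
    have hJ2 : J = Matrix.of fun a b => Sum.elim (fun j => if a = Sum.inl j then 1 else 0)
        (fun k => theta η W a k) b := by
      ext a b
      rcases a with i | k <;> rcases b with j | l <;> simp [hJ, theta, Matrix.one_apply]
    have hBapp : ∀ k l, B k l = (if k = l then (β : ℂ) else 0) + γ * (star (W k) * W l) := by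
      intro k l
      simp only [hB, Matrix.smul_apply, Matrix.add_apply, Matrix.one_apply, Matrix.mul_apply,
        Finset.univ_unique, Finset.sum_singleton, Matrix.replicateCol_apply,
        Matrix.replicateRow_apply, smul_eq_mul]
      push_cast
      split_ifs <;> field_simp
      simp
    have hth : ∀ a b, (∑ k, (∑ l, theta η W a l * B l k) * star (theta η W b k)) =
        β * ∑ k, theta η W a k * star (theta η W b k) +
          γ * (radial η W a * star (radial η W b)) := by
      intro a b
      simp only [hBapp, mul_add, Finset.sum_add_distrib, add_mul, mul_ite, mul_zero,
        Finset.sum_ite_eq', Finset.mem_univ, if_true, radial, star_sum, Finset.sum_mul_sum]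
      congr 1
      · rw [Finset.mul_sum]
        exact Finset.sum_congr rfl fun k _ => by ring
      · rw [Finset.sum_comm, Finset.mul_sum]
        simp only [Finset.sum_mul, Finset.mul_sum, star_mul', star_star]
        exact Finset.sum_congr rfl fun k _ => Finset.sum_congr rfl fun l _ => by ring
    ext a b
    rw [hJ2]
    simp only [Matrix.mul_apply, Fintype.sum_sum_type, Matrix.of_apply, Sum.elim_inl, Sum.elim_inr,
      Matrix.conjTranspose_apply, Matrix.fromBlocks_apply₁₁, Matrix.fromBlocks_apply₁₂,
      Matrix.fromBlocks_apply₂₁, Matrix.fromBlocks_apply₂₂, Matrix.zero_apply, mul_zero,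
      Finset.sum_const_zero, add_zero, zero_add, hth]
    simp only [adaptedForm, Matrix.add_apply, Matrix.smul_apply, Matrix.sum_apply, Matrix.of_apply,
      smul_eq_mul, add_assoc]
    congr 1
    rcases a with i | k <;> rcases b with j | l <;> simp [liftBase]
  rw [hfac, Matrix.det_mul, Matrix.det_mul, Matrix.det_conjTranspose, hJdet,
    Matrix.det_fromBlocks_zero₂₁, Matrix.det_smul, hBdet]
  simp

/-! ### Derivatives of functions on the product -/

/-- `basePart` as a continuous linear map. -/
def basePartL : (ι ⊕ Fin N → ℂ) →L[ℝ] (ι → ℂ) :=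
  ContinuousLinearMap.pi fun i => ContinuousLinearMap.proj (Sum.inl i)

theorem contDiff_basePart {k : WithTop ℕ∞} :
    ContDiff ℝ k (basePart : (ι ⊕ Fin N → ℂ) → ι → ℂ) :=
  (basePartL : (ι ⊕ Fin N → ℂ) →L[ℝ] (ι → ℂ)).contDiff

variable {z : ι ⊕ Fin N → ℂ}

theorem fderiv_comp_basePart {f : (ι → ℂ) → ℂ} (hf : DifferentiableAt ℝ f (basePart z)) :
    fderiv ℝ (fun w => f (basePart w)) z = (fderiv ℝ f (basePart z)).comp basePartL :=
  (hf.hasFDerivAt.comp z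
    (basePartL : (ι ⊕ Fin N → ℂ) →L[ℝ] (ι → ℂ)).hasFDerivAt).fderiv

theorem wd_inl_comp_basePart {c : ℂ} {i : ι} {f : (ι → ℂ) → ℂ}
    (hf : DifferentiableAt ℝ f (basePart z)) :
    wd c (Sum.inl i) (fun w => f (basePart w)) z = wd c i f (basePart z) := by
  have h : ∀ x : ℂ, (basePartL (Pi.single (Sum.inl i) x : ι ⊕ Fin N → ℂ)) = Pi.single i x := by
    intro x
    ext j
    simp [basePartL, Pi.single_apply]
  simp only [wd, fderiv_comp_basePart hf, ContinuousLinearMap.comp_apply, h]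

theorem wd_inr_comp_basePart {c : ℂ} {k : Fin N} {f : (ι → ℂ) → ℂ}
    (hf : DifferentiableAt ℝ f (basePart z)) :
    wd c (Sum.inr k) (fun w => f (basePart w)) z = 0 := by
  have h : ∀ x : ℂ, (basePartL (Pi.single (Sum.inr k) x : ι ⊕ Fin N → ℂ)) = 0 := by
    intro x
    ext j
    simp [basePartL]
  simp [wd, fderiv_comp_basePart hf, h]

theorem complexHessian_comp_basePart {f : (ι → ℂ) → ℝ} (hf : ContDiffAt ℝ 2 f (basePart z)) :
    complexHessian (fun w : ι ⊕ Fin N → ℂ => f (basePart w)) z =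
      liftBase N (complexHessian f (basePart z)) := by
  have hf' := contDiffAt_ofReal hf
  have hev : ∀ᶠ w in nhds z, DifferentiableAt ℝ (fun x => (f x : ℂ)) (basePart w) :=
    (contDiff_basePart (k := 0)).continuous.continuousAt.eventually hf'.eventually_differentiableAt
  have hd : ∀ j, DifferentiableAt ℝ (dzbar j fun x => (f x : ℂ)) (basePart z) := fun j =>
    differentiableAt_wd hf'
  ext a b
  rcases b with j | l
  · rw [complexHessian_apply_congr (g := fun w => dzbar j (fun x => (f x : ℂ)) (basePart w))]
    · rw [dz_eq_wd]
      rcases a with i | k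
      · rw [wd_inl_comp_basePart (hd j)]
        simp only [liftBase, complexHessian, Matrix.fromBlocks_apply₁₁, Matrix.of_apply, dz_eq_wd]
      · rw [wd_inr_comp_basePart (hd j)]
        simp [liftBase]
    · filter_upwards [hev] with w hw
      exact wd_inl_comp_basePart hw
  · rw [complexHessian_apply_congr (g := fun _ => 0), dz_eq_wd, wd_const]
    · rcases a with i | k <;> simp [liftBase]
    · filter_upwards [hev] with w hw
      exact wd_inr_comp_basePart hw

theorem ofReal_fibreSq (z : ι ⊕ Fin N → ℂ) :
    (fibreSq z : ℂ) = ∑ k, star (z (Sum.inr k)) * z (Sum.inr k) :=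
  (sum_star_mul_self fun k => z (Sum.inr k)).symm

theorem contDiff_fibreSq {k : WithTop ℕ∞} : ContDiff ℝ k (fibreSq : (ι ⊕ Fin N → ℂ) → ℝ) :=
  ContDiff.sum fun l _ => (contDiff_apply ℝ ℂ (Sum.inr l)).norm_sq ℝ

theorem dzbar_fibreSq (b : ι ⊕ Fin N) :
    dzbar b (fun w => (fibreSq w : ℂ)) z = Sum.elim (0 : ι → ℂ) (fun l => z (Sum.inr l)) b := by
  have hc : ∀ k, DifferentiableAt ℝ (fun w : ι ⊕ Fin N → ℂ => w (Sum.inr k)) z := fun k =>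
    (contDiff_apply ℝ ℂ (Sum.inr k)).differentiable one_ne_zero z
  have hs : ∀ k, DifferentiableAt ℝ (fun w : ι ⊕ Fin N → ℂ => star (w (Sum.inr k))) z := fun k =>
    (Complex.conjCLE : ℂ →L[ℝ] ℂ).differentiableAt.comp z (hc k)
  simp only [ofReal_fibreSq]
  rw [dzbar_eq_wd, wd_sum _ (fun k w => star (w (Sum.inr k)) * w (Sum.inr k))
    fun k _ => (hs k).mul (hc k), Finset.sum_congr rfl fun k _ => wd_mul (hs k) (hc k)]
  simp only [← dzbar_eq_wd, dzbar_star (hc _), dzbar_coord, dz_coord]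
  rcases b with i | l <;> simp

theorem dz_fibreSq (a : ι ⊕ Fin N) :
    dz a (fun w => (fibreSq w : ℂ)) z = Sum.elim (0 : ι → ℂ) (fun l => star (z (Sum.inr l))) a := by
  rw [dz_ofReal (contDiff_fibreSq.differentiable one_ne_zero z), dzbar_fibreSq]
  rcases a with i | l <;> simp

theorem complexHessian_fibreSq :
    complexHessian fibreSq z = (Matrix.fromBlocks 0 0 0 1 : Matrix (ι ⊕ Fin N) (ι ⊕ Fin N) ℂ) := by
  ext a b
  rw [complexHessian_apply_congr (Filter.Eventually.of_forall fun w => dzbar_fibreSq b)]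
  rcases b with j | l
  · simp only [Sum.elim_inl, Pi.zero_apply]
    rw [dz_eq_wd, wd_const]
    rcases a with i | k <;> simp
  · simp only [Sum.elim_inr, dz_coord]
    rcases a with i | k <;> simp [Matrix.one_apply]

end HartogsCalculus

/-! ### The potentials `φ` and `log Y` on a Hartogs domain -/

section AdaptedAlgebra

variable {ι : Type*} [Fintype ι] [DecidableEq ι] {N : ℕ} {Φ : Matrix ι ι ℂ} {η : ι → ℂ}
  {W : Fin N → ℂ}

theorem adaptedForm_add (α β γ α' β' γ' : ℝ) :
    adaptedForm Φ η W α β γ + adaptedForm Φ η W α' β' γ' =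
      adaptedForm Φ η W (α + α') (β + β') (γ + γ') := by
  simp only [adaptedForm, Complex.ofReal_add, add_smul]
  abel

theorem smul_adaptedForm (c α β γ : ℝ) :
    (c : ℂ) • adaptedForm Φ η W α β γ = adaptedForm Φ η W (c * α) (c * β) (c * γ) := by
  simp only [adaptedForm, Complex.ofReal_mul, smul_add, smul_smul]

theorem adaptedForm_one_zero_zero : adaptedForm Φ η W 1 0 0 = liftBase N Φ := by
  simp [adaptedForm]

theorem radial_inl (i : ι) : radial η W (Sum.inl i) = ((∑ k, ‖W k‖ ^ 2 : ℝ) : ℂ) * η i := by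
  rw [← sum_star_mul_self, Finset.sum_mul]
  exact Finset.sum_congr rfl fun k _ => by simp [theta]; ring

theorem radial_inr (l : Fin N) : radial η W (Sum.inr l) = star (W l) := by
  simp [radial, theta]

end AdaptedAlgebra

section Potentials

theorem two_le_infty : (2 : WithTop ℕ∞) ≤ ∞ :=
  WithTop.coe_le_coe.2 (le_top : (2 : ℕ∞) ≤ ⊤)

theorem hasDerivAt_neg_log_one_sub {x : ℝ} (hx : x < 1) :
    HasDerivAt (fun x => -Real.log (1 - x)) ((1 - x)⁻¹) x := by
  have := (((hasDerivAt_id' x).const_sub 1).log (sub_pos.2 hx).ne').fun_neg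
  rwa [neg_div, neg_neg, one_div] at this

theorem hasDerivAt_inv_one_sub {x : ℝ} (hx : x < 1) :
    HasDerivAt (fun x : ℝ => (1 - x)⁻¹) (((1 - x) ^ 2)⁻¹) x := by
  have := ((hasDerivAt_id' x).const_sub 1).fun_inv (sub_pos.2 hx).ne'
  rwa [neg_neg, one_div] at this

variable {ι : Type*} [Fintype ι] [DecidableEq ι] {N : ℕ} {h : (ι → ℂ) → ℝ} {K : ℝ}
  {z : ι ⊕ Fin N → ℂ}

/-- The Kähler potential `φ = -log h` of the base. -/
def basePot (h : (ι → ℂ) → ℝ) : (ι → ℂ) → ℝ := fun w => -Real.log (h w)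

/-- The function `log Y = -log (1 - X)`. -/
def fibrePot (h : (ι → ℂ) → ℝ) (K : ℝ) : (ι ⊕ Fin N → ℂ) → ℝ :=
  fun w => -Real.log (1 - fnX h K w)

/-- The coefficients `η_i = ∂_i φ / K` at the base point of `z`. -/
def connForm (h : (ι → ℂ) → ℝ) (K : ℝ) (z : ι ⊕ Fin N → ℂ) : ι → ℂ :=
  fun i => ((K⁻¹ : ℝ) : ℂ) * dz i (fun w => (basePot h w : ℂ)) (basePart z)

/-- The adapted form at the point `z`, built from `Φ = ∂∂̄φ`, `η = ∂φ / K` and `W`. -/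
def formAt (h : (ι → ℂ) → ℝ) (K : ℝ) (z : ι ⊕ Fin N → ℂ) (α β γ : ℝ) :
    Matrix (ι ⊕ Fin N) (ι ⊕ Fin N) ℂ :=
  adaptedForm (complexHessian (basePot h) (basePart z)) (connForm h K z)
    (fun k => z (Sum.inr k)) α β γ

theorem contDiffAt_basePot (hpos : 0 < h (basePart z)) (hs : ContDiffAt ℝ ∞ h (basePart z)) :
    ContDiffAt ℝ ∞ (basePot h) (basePart z) :=
  (hs.log hpos.ne').neg

theorem contDiffAt_basePot_basePart (hpos : 0 < h (basePart z))
    (hs : ContDiffAt ℝ ∞ h (basePart z)) :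
    ContDiffAt ℝ ∞ (fun w : ι ⊕ Fin N → ℂ => basePot h (basePart w)) z :=
  (contDiffAt_basePot hpos hs).comp z contDiff_basePart.contDiffAt

theorem rpow_neg_eq_exp {x : ℝ} (hx : 0 < x) (K : ℝ) :
    x ^ (-(1 / K)) = Real.exp (K⁻¹ * -Real.log x) := by
  rw [Real.rpow_def_of_pos hx]
  congr 1
  ring

theorem fnX_eventuallyEq (hpos : 0 < h (basePart z)) (hs : ContDiffAt ℝ ∞ h (basePart z)) :
    fnX h K =ᶠ[nhds z] fun w => fibreSq w * Real.exp (K⁻¹ * basePot h (basePart w)) := by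
  have hc : ContinuousAt (fun w : ι ⊕ Fin N → ℂ => h (basePart w)) z :=
    hs.continuousAt.comp (contDiff_basePart (k := 0)).continuous.continuousAt
  filter_upwards [hc.eventually (lt_mem_nhds hpos)] with w hw
  rw [fnX, rpow_neg_eq_exp hw, basePot]

theorem contDiffAt_exp_basePot (hpos : 0 < h (basePart z)) (hs : ContDiffAt ℝ ∞ h (basePart z)) :
    ContDiffAt ℝ ∞ (fun w : ι ⊕ Fin N → ℂ => Real.exp (K⁻¹ * basePot h (basePart w))) z :=
  (contDiffAt_const.mul (contDiffAt_basePot_basePart hpos hs)).exp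

theorem contDiffAt_fnX (hpos : 0 < h (basePart z)) (hs : ContDiffAt ℝ ∞ h (basePart z)) :
    ContDiffAt ℝ ∞ (fnX h K) z :=
  (contDiff_fibreSq.contDiffAt.mul (contDiffAt_exp_basePot hpos hs)).congr_of_eventuallyEq
    (fnX_eventuallyEq hpos hs)

theorem contDiffAt_fibrePot (hpos : 0 < h (basePart z)) (hs : ContDiffAt ℝ ∞ h (basePart z))
    (hX : fnX h K z < 1) : ContDiffAt ℝ ∞ (fibrePot h K) z :=
  ((contDiffAt_const.sub (contDiffAt_fnX hpos hs)).log (sub_pos.2 hX).ne').neg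

theorem complexHessian_basePot_basePart (hpos : 0 < h (basePart z))
    (hs : ContDiffAt ℝ ∞ h (basePart z)) :
    complexHessian (fun w : ι ⊕ Fin N → ℂ => basePot h (basePart w)) z = formAt h K z 1 0 0 := by
  rw [formAt, adaptedForm_one_zero_zero,
    complexHessian_comp_basePart ((contDiffAt_basePot hpos hs).of_le two_le_infty)]

theorem dz_scaled_basePot (hK : 0 < K) (hpos : 0 < h (basePart z))
    (hs : ContDiffAt ℝ ∞ h (basePart z)) (a : ι ⊕ Fin N) :
    dz a (fun w : ι ⊕ Fin N → ℂ => (basePot h (basePart w) : ℂ)) z =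
      K * Sum.elim (connForm h K z) 0 a := by
  have hd : DifferentiableAt ℝ (fun w => (basePot h w : ℂ)) (basePart z) :=
    (contDiffAt_ofReal (contDiffAt_basePot hpos hs)).differentiableAt (by simp)
  have hK' : (K : ℂ) ≠ 0 := by exact_mod_cast hK.ne'
  rw [dz_eq_wd]
  rcases a with i | k
  · rw [wd_inl_comp_basePart hd, Sum.elim_inl, connForm, dz_eq_wd]
    push_cast
    field_simp
  · rw [wd_inr_comp_basePart hd]
    simp

theorem dzbar_ofReal {κ : Type*} [Fintype κ] [DecidableEq κ] {u : (κ → ℂ) → ℝ} {x : κ → ℂ}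
    {i : κ} (hu : DifferentiableAt ℝ u x) :
    dzbar i (fun w => (u w : ℂ)) x = star (dz i (fun w => (u w : ℂ)) x) := by
  rw [dz_ofReal hu, star_star]

/-- `∂e^{φ/K} = e^{φ/K} η`. -/
theorem dz_exp_basePot (hK : 0 < K) (hpos : 0 < h (basePart z))
    (hs : ContDiffAt ℝ ∞ h (basePart z)) (a : ι ⊕ Fin N) :
    dz a (fun w : ι ⊕ Fin N → ℂ => (Real.exp (K⁻¹ * basePot h (basePart w)) : ℂ)) z =
      (Real.exp (K⁻¹ * basePot h (basePart z)) : ℂ) * Sum.elim (connForm h K z) 0 a := by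
  have hd := (contDiffAt_basePot_basePart hpos hs).differentiableAt (by simp)
  have hK' : (K : ℂ) ≠ 0 := by exact_mod_cast hK.ne'
  have h1 : HasDerivAt (fun x => Real.exp (K⁻¹ * x))
      (Real.exp (K⁻¹ * basePot h (basePart z)) * (K⁻¹ * 1)) (basePot h (basePart z)) :=
    ((hasDerivAt_id _).const_mul K⁻¹).exp
  have h2 := dz_scaled_basePot hK hpos hs a
  rw [dz_eq_wd] at h2
  rw [dz_eq_wd, wd_ofReal_comp (u := fun w => basePot h (basePart w)) h1 hd, h2]
  push_cast
  field_simp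

theorem complexHessian_exp_basePot (hK : 0 < K) (hpos : 0 < h (basePart z))
    (hs : ContDiffAt ℝ ∞ h (basePart z)) :
    complexHessian (fun w : ι ⊕ Fin N → ℂ => Real.exp (K⁻¹ * basePot h (basePart w))) z =
      (Real.exp (K⁻¹ * basePot h (basePart z)) : ℂ) •
        (((K⁻¹ : ℝ) : ℂ) • liftBase N (complexHessian (basePot h) (basePart z)) +
          Matrix.of fun a b => (Sum.elim (connForm h K z) 0 a : ℂ) *
            star (Sum.elim (connForm h K z) 0 b)) := by
  have hd := (contDiffAt_basePot_basePart (N := N) hpos hs).differentiableAt (by simp)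
  have hK' : (K : ℂ) ≠ 0 := by exact_mod_cast hK.ne'
  have h1 : ∀ x : ℝ, HasDerivAt (fun x => Real.exp (K⁻¹ * x)) (Real.exp (K⁻¹ * x) * K⁻¹) x :=
    fun x => by simpa using ((hasDerivAt_id x).const_mul K⁻¹).exp
  rw [complexHessian_comp (F := fun x => Real.exp (K⁻¹ * x))
    ((contDiffAt_basePot_basePart hpos hs).of_le two_le_infty)
    (Filter.Eventually.of_forall h1) ((h1 _).mul_const K⁻¹),
    complexHessian_comp_basePart ((contDiffAt_basePot hpos hs).of_le two_le_infty)]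
  ext a b
  simp only [Matrix.add_apply, Matrix.smul_apply, Matrix.of_apply, smul_eq_mul, dzbar_ofReal hd,
    dz_scaled_basePot hK hpos hs, star_mul']
  simp only [Complex.ofReal_mul, Complex.ofReal_inv, RCLike.star_def, Complex.conj_ofReal]
  field_simp

theorem fnX_eq (hpos : 0 < h (basePart z)) :
    fnX h K z = fibreSq z * Real.exp (K⁻¹ * basePot h (basePart z)) := by
  rw [fnX, rpow_neg_eq_exp hpos, basePot]

/-- `∂X = e^{φ/K} ∑ W̄_k θ_k`. -/
theorem dz_fnX (hK : 0 < K) (hpos : 0 < h (basePart z))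
    (hs : ContDiffAt ℝ ∞ h (basePart z)) (a : ι ⊕ Fin N) :
    dz a (fun w => (fnX h K w : ℂ)) z = (Real.exp (K⁻¹ * basePot h (basePart z)) : ℂ) *
      radial (connForm h K z) (fun k => z (Sum.inr k)) a := by
  have hE := (contDiffAt_ofReal (contDiffAt_exp_basePot (K := K) hpos hs)).differentiableAt
    (by simp)
  have hF : DifferentiableAt ℝ (fun w : ι ⊕ Fin N → ℂ => (fibreSq w : ℂ)) z :=
    (contDiffAt_ofReal (contDiff_fibreSq (k := 1)).contDiffAt).differentiableAt (by simp)
  have h1 := dz_exp_basePot hK hpos hs a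
  have h2 := dz_fibreSq (z := z) a
  rw [dz_eq_wd] at h1 h2 ⊢
  rw [wd_congr (f := fun w => (fnX h K w : ℂ))
    (g := fun w => ((fibreSq w * Real.exp (K⁻¹ * basePot h (basePart w)) : ℝ) : ℂ))
    ((fnX_eventuallyEq hpos hs).fun_comp Complex.ofReal)]
  simp only [Complex.ofReal_mul]
  rw [wd_mul hF hE, h1, h2]
  rcases a with i | k
  · rw [radial_inl]
    simp only [Sum.elim_inl, fibreSq, Pi.zero_apply]
    ring
  · rw [radial_inr]
    simp only [Sum.elim_inr, Pi.zero_apply]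
    ring

/-- `∂∂̄X = (X / K) Φ + e^{φ/K} ∑ |θ_k|²`. -/
theorem complexHessian_fnX (hK : 0 < K) (hpos : 0 < h (basePart z))
    (hs : ContDiffAt ℝ ∞ h (basePart z)) :
    complexHessian (fnX h K) z =
      formAt h K z (fnX h K z / K) (Real.exp (K⁻¹ * basePot h (basePart z))) 0 := by
  have hE := contDiffAt_exp_basePot (K := K) (z := z) hpos hs
  rw [complexHessian_congr (fnX_eventuallyEq hpos hs), complexHessian_mul
    contDiff_fibreSq.contDiffAt (hE.of_le two_le_infty), complexHessian_exp_basePot hK hpos hs,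
    complexHessian_fibreSq, fnX_eq hpos]
  ext a b
  simp only [Matrix.add_apply, Matrix.smul_apply, Matrix.of_apply, smul_eq_mul, formAt,
    adaptedForm, Matrix.sum_apply, dzbar_ofReal (hE.differentiableAt (by simp)), dzbar_fibreSq,
    dz_exp_basePot hK hpos hs, dz_fibreSq, star_mul']
  have hn : ∀ x y : ℂ, ∑ k, z (Sum.inr k) * x * star (z (Sum.inr k) * y) =
      (fibreSq z : ℂ) * (x * star y) := fun x y => by
    rw [ofReal_fibreSq, Finset.sum_mul]
    refine Finset.sum_congr rfl fun k _ => ?_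
    rw [star_mul']
    ring
  generalize Real.exp (K⁻¹ * basePot h (basePart z)) = e
  rcases a with i | k <;> rcases b with j | l
  · simp only [theta, Matrix.of_apply, Sum.elim_inl, hn]
    simp [liftBase]
    ring
  · simp [theta, liftBase]
    ring
  · simp [theta, liftBase]
    ring
  · simp [theta, liftBase, Matrix.one_apply, eq_comm]

theorem dz_fibrePot (hK : 0 < K) (hpos : 0 < h (basePart z))
    (hs : ContDiffAt ℝ ∞ h (basePart z)) (hX : fnX h K z < 1) (a : ι ⊕ Fin N) :
    dz a (fun w => (fibrePot h K w : ℂ)) z = (fnY h K z : ℂ) *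
      ((Real.exp (K⁻¹ * basePot h (basePart z)) : ℂ) *
        radial (connForm h K z) (fun k => z (Sum.inr k)) a) := by
  have h2 := dz_fnX hK hpos hs a
  rw [dz_eq_wd] at h2 ⊢
  unfold fibrePot
  rw [wd_ofReal_comp (F := fun x => -Real.log (1 - x)) (hasDerivAt_neg_log_one_sub hX)
    ((contDiffAt_fnX hpos hs).differentiableAt (by simp)), h2, fnY]

/-- The rank one form `∂ log Y ∧ ∂̄ log Y`. -/
theorem dz_mul_dzbar_fibrePot (hK : 0 < K) (hpos : 0 < h (basePart z))
    (hs : ContDiffAt ℝ ∞ h (basePart z)) (hX : fnX h K z < 1) :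
    (Matrix.of fun a b => dz a (fun w => (fibrePot h K w : ℂ)) z *
      dzbar b (fun w => (fibrePot h K w : ℂ)) z) = formAt h K z 0 0
        ((fnY h K z * Real.exp (K⁻¹ * basePot h (basePart z))) ^ 2) := by
  have hd := (contDiffAt_fibrePot hpos hs hX).differentiableAt (by simp)
  ext a b
  simp only [dzbar_ofReal hd, dz_fibrePot hK hpos hs hX, formAt, adaptedForm, Matrix.of_apply,
    Matrix.add_apply, Matrix.smul_apply, smul_eq_mul, star_mul']
  simp only [RCLike.star_def, Complex.conj_ofReal]
  push_cast
  ring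

/-- `∂∂̄ log Y = (X Y / K) Φ + Y e^{φ/K} ∑ |θ_k|² + Y² e^{2φ/K} |∑ W̄_k θ_k|²`. -/
theorem complexHessian_fibrePot (hK : 0 < K) (hpos : 0 < h (basePart z))
    (hs : ContDiffAt ℝ ∞ h (basePart z)) (hX : fnX h K z < 1) :
    complexHessian (fibrePot h K) z = formAt h K z (fnX h K z * fnY h K z / K)
      (fnY h K z * Real.exp (K⁻¹ * basePot h (basePart z)))
      ((fnY h K z * Real.exp (K⁻¹ * basePot h (basePart z))) ^ 2) := by
  have hd := (contDiffAt_fnX (K := K) hpos hs).differentiableAt (by simp)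
  have h3 : (Matrix.of fun a b => dz a (fun w => (fnX h K w : ℂ)) z *
      dzbar b (fun w => (fnX h K w : ℂ)) z) = formAt h K z 0 0
        (Real.exp (K⁻¹ * basePot h (basePart z)) ^ 2) := by
    ext a b
    simp only [dzbar_ofReal hd, dz_fnX hK hpos hs, formAt, adaptedForm, Matrix.of_apply,
      Matrix.add_apply, Matrix.smul_apply, smul_eq_mul, star_mul']
    simp only [RCLike.star_def, Complex.conj_ofReal]
    push_cast
    ring
  unfold fibrePot
  rw [complexHessian_comp (F := fun x => -Real.log (1 - x))
    ((contDiffAt_fnX hpos hs).of_le two_le_infty)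
    (Filter.eventually_of_mem (Iio_mem_nhds hX) fun x => hasDerivAt_neg_log_one_sub)
    (hasDerivAt_inv_one_sub hX), complexHessian_fnX hK hpos hs, h3, formAt,
    formAt, formAt, smul_adaptedForm, smul_adaptedForm, adaptedForm_add, fnY]
  have hne : 1 - fnX h K z ≠ 0 := (sub_pos.2 hX).ne'
  congr 1 <;> field_simp <;> ring

end Potentials

/-! ### The metric, its determinant and the Ricci bounds -/

section Pinching

/-- For `L(u) = log (a e^u + c - a)` and `Y = e^u`, the form `∂∂̄ L(u) = L'(u) H + L''(u) P`, with
`H = ∂∂̄u` and `P = ∂u ∂̄u`, lies between `0` and a constant multiple of `H`. If `c < a` then `L''`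
is negative, and the lower bound needs `P ≤ (1 - 1 / Y) H` rather than `P ≤ H`. -/
theorem logAffine_bounds {a c Y H P : ℝ} (ha : 0 < a) (hc : 0 < c) (hY : 1 ≤ Y) (hH : 0 ≤ H)
    (hP : 0 ≤ P) (hPH : Y * P ≤ (Y - 1) * H) :
    0 ≤ a * Y / (a * Y + (c - a)) * H + a * Y * (c - a) / (a * Y + (c - a)) ^ 2 * P ∧
      a * Y / (a * Y + (c - a)) * H + a * Y * (c - a) / (a * Y + (c - a)) ^ 2 * P ≤
        (1 + a / c) * (1 + |c - a| / c) * H := by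
  set A := a * Y + (c - a) with hA
  have hY0 : 0 < Y := by linarith
  have hAc : c ≤ A := by nlinarith
  have hA0 : 0 < A := hc.trans_le hAc
  have hPH' : P ≤ H := by nlinarith
  constructor
  · have e : a * Y / A * H + a * Y * (c - a) / A ^ 2 * P =
        a / A ^ 2 * (Y * A * H + (c - a) * (Y * P)) := by
      field_simp
    rw [e]
    refine mul_nonneg (by positivity) ?_
    rcases le_total a c with h | h
    · have : 0 ≤ c - a := by linarith
      positivity
    · have h1 : (c - a) * ((Y - 1) * H) ≤ (c - a) * (Y * P) :=
        mul_le_mul_of_nonpos_left hPH (by linarith)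
      have h2 : Y * A * H + (c - a) * ((Y - 1) * H) = (a * (Y - 1) ^ 2 + c * (2 * Y - 1)) * H := by
        rw [hA]
        ring
      have h3 : 0 ≤ (a * (Y - 1) ^ 2 + c * (2 * Y - 1)) * H := by
        have : 0 ≤ 2 * Y - 1 := by linarith
        positivity
      linarith
  · have h1 : a * Y / A ≤ 1 + a / c := by
      rw [div_le_iff₀ hA0]
      have e : (1 + a / c) * A = a * Y + c + a / c * (a * (Y - 1)) := by
        rw [hA]
        field_simp
        ring
      have : 0 ≤ a / c * (a * (Y - 1)) := by
        have : 0 ≤ Y - 1 := by linarith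
        positivity
      linarith
    have h2 : (c - a) / A ≤ |c - a| / c :=
      div_le_div₀ (abs_nonneg _) (le_abs_self _) hc hAc
    have h3 : (c - a) / A * P ≤ |c - a| / c * H :=
      (mul_le_mul_of_nonneg_right h2 hP).trans (mul_le_mul_of_nonneg_left hPH' (by positivity))
    have e : a * Y / A * H + a * Y * (c - a) / A ^ 2 * P =
        a * Y / A * (H + (c - a) / A * P) := by
      field_simp
    rw [e]
    have h4 : H + (c - a) / A * P ≤ (1 + |c - a| / c) * H := by linarith
    calc a * Y / A * (H + (c - a) / A * P)
        ≤ a * Y / A * ((1 + |c - a| / c) * H) := mul_le_mul_of_nonneg_left h4 (by positivity)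
      _ ≤ (1 + a / c) * ((1 + |c - a| / c) * H) := mul_le_mul_of_nonneg_right h1 (by positivity)
      _ = _ := by ring

variable {ι : Type*} [Fintype ι] [DecidableEq ι] {N : ℕ} {R : Set (ι → ℂ)} {h : (ι → ℂ) → ℝ}
  {K g lam : ℝ} {z : ι ⊕ Fin N → ℂ}

theorem fibreSq_nonneg (z : ι ⊕ Fin N → ℂ) : 0 ≤ fibreSq z :=
  Finset.sum_nonneg fun _ _ => by positivity

theorem fnX_nonneg (hpos : 0 < h (basePart z)) : 0 ≤ fnX h K z :=
  mul_nonneg (fibreSq_nonneg z) (Real.rpow_pos_of_pos hpos _).le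

theorem fnX_lt_one (hK : 0 < K) (hpos : 0 < h (basePart z))
    (hz : fibreSq z ^ K < h (basePart z)) : fnX h K z < 1 := by
  have h1 : fibreSq z < h (basePart z) ^ (1 / K) := by
    have := Real.rpow_lt_rpow (Real.rpow_nonneg (fibreSq_nonneg z) K) hz
      (one_div_pos.2 hK)
    rwa [← Real.rpow_mul (fibreSq_nonneg z), mul_one_div_cancel hK.ne', Real.rpow_one] at this
  calc fnX h K z < h (basePart z) ^ (1 / K) * h (basePart z) ^ (-(1 / K)) :=
        mul_lt_mul_of_pos_right h1 (Real.rpow_pos_of_pos hpos _)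
    _ = 1 := by rw [← Real.rpow_add hpos, add_neg_cancel, Real.rpow_zero]

theorem eventually_mem_hartogsDomain (hB : IsEinsteinBase R h g) (hK : 0 < K)
    (hz : z ∈ hartogsDomain R h N K) : ∀ᶠ w in nhds z, w ∈ hartogsDomain R h N K := by
  have hb : ContinuousAt (basePart : (ι ⊕ Fin N → ℂ) → ι → ℂ) z :=
    (contDiff_basePart (k := 0)).continuous.continuousAt
  have h1 : ContinuousAt (fun w : ι ⊕ Fin N → ℂ => fibreSq w ^ K) z :=
    (contDiff_fibreSq (k := 0)).continuous.continuousAt.rpow_const (Or.inr hK.le)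
  have h2 : ContinuousAt (fun w : ι ⊕ Fin N → ℂ => h (basePart w)) z :=
    (hB.smooth _ hz.1).continuousAt.comp hb
  exact (hb.eventually (hB.isOpen.mem_nhds hz.1)).and (h1.eventually_lt h2 hz.2)

theorem fnY_pos (hX : fnX h K z < 1) : 0 < fnY h K z := inv_pos.2 (sub_pos.2 hX)

theorem log_fnY : Real.log (fnY h K z) = fibrePot h K z := by
  rw [fnY, Real.log_inv, fibrePot]

theorem exp_fibrePot (hX : fnX h K z < 1) : Real.exp (fibrePot h K z) = fnY h K z := by
  rw [← log_fnY, Real.exp_log (fnY_pos hX)]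

theorem fnX_mul_fnY (hX : fnX h K z < 1) : fnX h K z * fnY h K z = fnY h K z - 1 := by
  have : 1 - fnX h K z ≠ 0 := (sub_pos.2 hX).ne'
  rw [fnY]
  field_simp
  ring

theorem log_fnG (hpos : 0 < h (basePart z)) (hX : fnX h K z < 1) :
    Real.log (fnG h g K lam z) = lam * fibrePot h K z + (g + N / K) * basePot h (basePart z) := by
  rw [fnG, Real.log_mul (Real.rpow_pos_of_pos (fnY_pos hX) _).ne'
    (Real.rpow_pos_of_pos hpos _).ne', Real.log_rpow (fnY_pos hX), Real.log_rpow hpos, log_fnY,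
    basePot]
  ring

theorem log_fnG_eventuallyEq (hB : IsEinsteinBase R h g) (hK : 0 < K)
    (hz : z ∈ hartogsDomain R h N K) :
    (fun w => Real.log (fnG h g K lam w)) =ᶠ[nhds z]
      fun w => lam * fibrePot h K w + (g + N / K) * basePot h (basePart w) := by
  filter_upwards [eventually_mem_hartogsDomain hB hK hz] with w hw
  exact log_fnG (hB.pos _ hw.1) (fnX_lt_one hK (hB.pos _ hw.1) hw.2)

/-- `T_λ = λ ∂∂̄ log Y + (g + N / K) Φ`. -/
theorem metricMatrix_fnG (hB : IsEinsteinBase R h g) (hK : 0 < K)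
    (hz : z ∈ hartogsDomain R h N K) :
    metricMatrix (fnG h g K lam) z =
      formAt h K z (lam * (fnX h K z * fnY h K z / K) + (g + N / K))
        (lam * (fnY h K z * Real.exp (K⁻¹ * basePot h (basePart z))))
        (lam * (fnY h K z * Real.exp (K⁻¹ * basePot h (basePart z))) ^ 2) := by
  have hpos := hB.pos _ hz.1
  have hs := hB.smooth _ hz.1
  have hX := fnX_lt_one hK hpos hz.2
  have hu := (contDiffAt_fibrePot hpos hs hX).of_le two_le_infty
  have hφ := (contDiffAt_basePot_basePart hpos hs).of_le two_le_infty
  rw [metricMatrix, complexHessian_congr (log_fnG_eventuallyEq hB hK hz),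
    complexHessian_add (contDiffAt_const.mul hu) (contDiffAt_const.mul hφ),
    complexHessian_const_mul _ hu, complexHessian_const_mul _ hφ,
    complexHessian_fibrePot hK hpos hs hX, complexHessian_basePot_basePart (K := K) hpos hs]
  simp only [formAt, smul_adaptedForm, adaptedForm_add]
  congr 1 <;> ring

/-- The coefficient of `Φ` in `T_λ`, as a function of `u = log Y`. -/
def baseCoeff (a c u : ℝ) : ℝ := a * Real.exp u + (c - a)

theorem baseCoeff_fibrePot (hX : fnX h K z < 1) (c : ℝ) :
    lam * (fnX h K z * fnY h K z / K) + c = baseCoeff (lam / K) c (fibrePot h K z) := by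
  rw [baseCoeff, exp_fibrePot hX, fnX_mul_fnY hX]
  ring

theorem baseCoeff_pos {a c : ℝ} (ha : 0 < a) (hc : 0 < c) (hpos : 0 < h (basePart z))
    (hX : fnX h K z < 1) : 0 < baseCoeff a c (fibrePot h K z) := by
  rw [baseCoeff, exp_fibrePot hX]
  have h1 := fnX_mul_fnY hX
  have h2 := mul_nonneg (fnX_nonneg (K := K) hpos) (fnY_pos hX).le
  have h3 : 0 ≤ a * (fnY h K z - 1) := mul_nonneg ha.le (by linarith)
  linarith

/-- Since the base is Einstein, `log det T_λ` is up to a constant a combination of the functions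
`log A`, `log Y` and `φ`, where `A` is the coefficient of `Φ` in `T_λ`. -/
theorem exists_log_det_metricMatrix (hB : IsEinsteinBase R h g) (hc : 0 < g + N / K) (hK : 0 < K)
    (hlam : 0 < lam) : ∃ C : ℝ, ∀ w ∈ hartogsDomain R h N K,
      Real.log (metricMatrix (fnG h g K lam) w).det.re =
        Fintype.card ι * Real.log (baseCoeff (lam / K) (g + N / K) (fibrePot h K w)) +
          (N + 1) * fibrePot h K w + (g + N / K) * basePot h (basePart w) + C := by
  obtain ⟨c, hc0, hdet⟩ := hB.det_eq
  refine ⟨Real.log c + N * Real.log lam, fun w hw => ?_⟩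
  have hpos := hB.pos _ hw.1
  have hX := fnX_lt_one hK hpos hw.2
  have hY := fnY_pos hX
  have hA := baseCoeff_pos (div_pos hlam hK) hc hpos hX
  set e := Real.exp (K⁻¹ * basePot h (basePart w)) with he
  have he0 : 0 < e := Real.exp_pos _
  have hβ : 0 < lam * (fnY h K w * e) := by positivity
  have hlast : 1 + lam * (fnY h K w * e) ^ 2 / (lam * (fnY h K w * e)) *
      ∑ k, ‖w (Sum.inr k)‖ ^ 2 = fnY h K w := by
    have h1 : lam * (fnY h K w * e) ^ 2 / (lam * (fnY h K w * e)) = fnY h K w * e := by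
      field_simp
    have h2 : fnX h K w = (∑ k, ‖w (Sum.inr k)‖ ^ 2) * e := fnX_eq hpos
    have h3 := fnX_mul_fnY hX
    rw [h1]
    rw [h2] at h3
    linarith
  have hreal : (metricMatrix (fnG h g K lam) w).det =
      ((baseCoeff (lam / K) (g + N / K) (fibrePot h K w) ^ Fintype.card ι *
        (c * h (basePart w) ^ (-g)) * ((lam * (fnY h K w * e)) ^ N * fnY h K w) : ℝ) : ℂ) := by
    rw [metricMatrix_fnG hB hK hw, formAt, det_adaptedForm _ _ _ hβ.ne', ← he, hlast,
      baseCoeff_fibrePot hX]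
    have := hdet _ hw.1
    unfold basePot
    rw [this]
    push_cast
    ring
  have hhg := Real.rpow_pos_of_pos hpos (-g)
  rw [hreal, Complex.ofReal_re, Real.log_mul (by positivity) (by positivity),
    Real.log_mul (by positivity) (by positivity), Real.log_mul hc0.ne' hhg.ne',
    Real.log_mul (by positivity) hY.ne', Real.log_pow, Real.log_pow, Real.log_rpow hpos,
    Real.log_mul hlam.ne' (by positivity), Real.log_mul hY.ne' he0.ne', he, Real.log_exp, log_fnY,
    basePot]
  ring

theorem hasDerivAt_log_baseCoeff {a c x : ℝ} (hx : baseCoeff a c x ≠ 0) :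
    HasDerivAt (fun u => Real.log (baseCoeff a c u)) (a * Real.exp x / baseCoeff a c x) x := by
  have h1 : HasDerivAt (baseCoeff a c) (a * Real.exp x) x :=
    ((Real.hasDerivAt_exp x).const_mul a).add_const _
  exact h1.log hx

theorem hasDerivAt_deriv_log_baseCoeff {a c x : ℝ} (hx : baseCoeff a c x ≠ 0) :
    HasDerivAt (fun u => a * Real.exp u / baseCoeff a c u)
      (a * Real.exp x * (c - a) / baseCoeff a c x ^ 2) x := by
  have h1 : HasDerivAt (baseCoeff a c) (a * Real.exp x) x :=
    ((Real.hasDerivAt_exp x).const_mul a).add_const _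
  refine (((Real.hasDerivAt_exp x).const_mul a).fun_div h1 hx).congr_deriv ?_
  have h2 : baseCoeff a c x - a * Real.exp x = c - a := by
    rw [baseCoeff]
    ring
  rw [← h2]
  ring

theorem contDiff_baseCoeff {a c : ℝ} {n : WithTop ℕ∞} : ContDiff ℝ n (baseCoeff a c) :=
  (contDiff_const.mul Real.contDiff_exp).add contDiff_const

/-- The value at `v` of the rank one form `∂ log Y ∧ ∂̄ log Y` at the point `z`. -/
def gradForm (h : (ι → ℂ) → ℝ) (K : ℝ) (z v : ι ⊕ Fin N → ℂ) : ℝ :=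
  hermForm (Matrix.of fun a b => dz a (fun w => (fibrePot h K w : ℂ)) z *
    dzbar b (fun w => (fibrePot h K w : ℂ)) z) v

theorem gradForm_eq (hK : 0 < K) (hpos : 0 < h (basePart z))
    (hs : ContDiffAt ℝ ∞ h (basePart z)) (hX : fnX h K z < 1) (v : ι ⊕ Fin N → ℂ) :
    gradForm h K z v = (fnY h K z * Real.exp (K⁻¹ * basePot h (basePart z))) ^ 2 *
      ‖∑ a, v a * radial (connForm h K z) (fun k => z (Sum.inr k)) a‖ ^ 2 := by
  rw [gradForm, dz_mul_dzbar_fibrePot hK hpos hs hX, formAt, hermForm_adaptedForm]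
  ring

/-- The gradient term is dominated by the Hessian: `∂ log Y ∧ ∂̄ log Y ≤ X ∂∂̄ log Y`, where
`X = (Y - 1) / Y`. -/
theorem gradForm_bounds (hB : IsEinsteinBase R h g) (hK : 0 < K)
    (hz : z ∈ hartogsDomain R h N K) (v : ι ⊕ Fin N → ℂ) :
    0 ≤ gradForm h K z v ∧ 0 ≤ hermForm (complexHessian (fibrePot h K) z) v ∧
      fnY h K z * gradForm h K z v ≤
        (fnY h K z - 1) * hermForm (complexHessian (fibrePot h K) z) v := by
  have hpos := hB.pos _ hz.1
  have hs := hB.smooth _ hz.1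
  have hX := fnX_lt_one hK hpos hz.2
  have hX0 : 0 ≤ fnX h K z := fnX_nonneg hpos
  have hY := fnY_pos hX
  have hXY := fnX_mul_fnY hX
  have hF0 := hermForm_nonneg (hB.posDef _ hz.1) (fun i => v (Sum.inl i))
  have hCS := norm_sum_radial_sq_le (η := connForm h K z) (W := fun k => z (Sum.inr k)) v
  have hXe : fnX h K z = (∑ k, ‖z (Sum.inr k)‖ ^ 2) * Real.exp (K⁻¹ * basePot h (basePart z)) :=
    fnX_eq hpos
  have he0 := Real.exp_pos (K⁻¹ * basePot h (basePart z))
  have hQ0 : 0 ≤ ∑ k, ‖∑ a, v a * theta (connForm h K z) (fun k => z (Sum.inr k)) a k‖ ^ 2 :=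
    Finset.sum_nonneg fun _ _ => by positivity
  have hΛ0 : 0 ≤ ‖∑ a, v a * radial (connForm h K z) (fun k => z (Sum.inr k)) a‖ ^ 2 := by
    positivity
  rw [gradForm_eq hK hpos hs hX, complexHessian_fibrePot hK hpos hs hX, formAt,
    hermForm_adaptedForm]
  change 0 ≤ hermForm (complexHessian (basePot h) (basePart z)) (fun i => v (Sum.inl i)) at hF0
  generalize hermForm (complexHessian (basePot h) (basePart z)) (fun i => v (Sum.inl i)) = F at *
  generalize Real.exp (K⁻¹ * basePot h (basePart z)) = e at *
  generalize ∑ k, ‖∑ a, v a * theta (connForm h K z) (fun k => z (Sum.inr k)) a k‖ ^ 2 = Q at *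
  generalize ‖∑ a, v a * radial (connForm h K z) (fun k => z (Sum.inr k)) a‖ ^ 2 = Λ at *
  generalize fnY h K z = Y at *
  generalize fnX h K z = X at *
  generalize ∑ k, ‖z (Sum.inr k)‖ ^ 2 = n at *
  refine ⟨by positivity, by positivity, ?_⟩
  have h1 : Λ * e ≤ X * Q := by
    rw [hXe]
    nlinarith [mul_le_mul_of_nonneg_right hCS he0.le]
  have h2 : (Y * e) ^ 2 * Λ ≤ X * Y * (Y * e * Q) := by
    have := mul_le_mul_of_nonneg_left h1 (show 0 ≤ Y ^ 2 * e by positivity)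
    linarith
  have h3 : 0 ≤ X * Y * (X * Y / K * F) := by positivity
  have h4 : Y = X * Y + 1 := by linarith
  calc Y * ((Y * e) ^ 2 * Λ) = (X * Y + 1) * ((Y * e) ^ 2 * Λ) := by rw [← h4]
    _ ≤ (Y - 1) * (X * Y / K * F + Y * e * Q + (Y * e) ^ 2 * Λ) := by
      rw [← hXY]
      linarith

theorem hermForm_metricMatrix_fnG (hB : IsEinsteinBase R h g) (hK : 0 < K)
    (hz : z ∈ hartogsDomain R h N K) (v : ι ⊕ Fin N → ℂ) :
    hermForm (metricMatrix (fnG h g K lam) z) v =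
      lam * hermForm (complexHessian (fibrePot h K) z) v +
        (g + N / K) * hermForm (formAt h K z 1 0 0) v := by
  have hpos := hB.pos _ hz.1
  rw [← hermForm_smul, ← hermForm_smul, ← hermForm_add, metricMatrix_fnG hB hK hz,
    complexHessian_fibrePot hK hpos (hB.smooth _ hz.1) (fnX_lt_one hK hpos hz.2)]
  simp only [formAt, smul_adaptedForm, adaptedForm_add]
  congr 2 <;> ring

/-- The value at `v` of `∂∂̄ log det T_λ`, the negative of the Ricci form: it is
`d (L'(u) H + L''(u) P) + (N + 1) H + c Φ` with `u = log Y` and `L = log ∘ baseCoeff`. -/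
theorem hermForm_hessian_log_det (hB : IsEinsteinBase R h g) (hc : 0 < g + N / K) (hK : 0 < K)
    (hlam : 0 < lam) (hz : z ∈ hartogsDomain R h N K) (v : ι ⊕ Fin N → ℂ) :
    hermForm (complexHessian
      (fun w => Real.log (metricMatrix (fnG h g K lam) w).det.re) z) v =
      Fintype.card ι * (lam / K * fnY h K z / (lam / K * fnY h K z + (g + N / K - lam / K)) *
          hermForm (complexHessian (fibrePot h K) z) v +
        lam / K * fnY h K z * (g + N / K - lam / K) /
          (lam / K * fnY h K z + (g + N / K - lam / K)) ^ 2 * gradForm h K z v) +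
      (N + 1) * hermForm (complexHessian (fibrePot h K) z) v +
      (g + N / K) * hermForm (formAt h K z 1 0 0) v := by
  obtain ⟨C, hC⟩ := exists_log_det_metricMatrix hB hc hK hlam
  have hpos := hB.pos _ hz.1
  have hs := hB.smooth _ hz.1
  have hX := fnX_lt_one hK hpos hz.2
  have ha : 0 < lam / K := by positivity
  generalize g + N / K = c at *
  generalize lam / K = a at *
  have hA := baseCoeff_pos ha hc hpos hX
  have hu := (contDiffAt_fibrePot hpos hs hX).of_le two_le_infty
  have hφ := (contDiffAt_basePot_basePart hpos hs).of_le two_le_infty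
  have hL : ContDiffAt ℝ 2 (fun w => Real.log (baseCoeff a c (fibrePot h K w))) z :=
    (contDiff_baseCoeff.contDiffAt.comp z hu).log hA.ne'
  have hAev : ∀ᶠ x in nhds (fibrePot h K z),
      HasDerivAt (fun u => Real.log (baseCoeff a c u)) (a * Real.exp x / baseCoeff a c x) x := by
    filter_upwards [(contDiff_baseCoeff (n := 0)).continuous.continuousAt.eventually_ne hA.ne']
      with x hx
    exact hasDerivAt_log_baseCoeff hx
  have hgerm : (fun w => Real.log (metricMatrix (fnG h g K lam) w).det.re) =ᶠ[nhds z]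
      fun w => Fintype.card ι * Real.log (baseCoeff a c (fibrePot h K w)) +
        (N + 1) * fibrePot h K w + c * basePot h (basePart w) + C := by
    filter_upwards [eventually_mem_hartogsDomain hB hK hz] with w hw
    exact hC w hw
  have hd := hasDerivAt_deriv_log_baseCoeff hA.ne'
  rw [complexHessian_congr hgerm,
    complexHessian_add (((contDiffAt_const.mul hL).add (contDiffAt_const.mul hu)).add
      (contDiffAt_const.mul hφ)) contDiffAt_const,
    complexHessian_add ((contDiffAt_const.mul hL).add (contDiffAt_const.mul hu))
      (contDiffAt_const.mul hφ),
    complexHessian_add (contDiffAt_const.mul hL) (contDiffAt_const.mul hu),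
    complexHessian_const_mul _ hL, complexHessian_const_mul _ hφ,
    complexHessian_const, add_zero, complexHessian_basePot_basePart (K := K) hpos hs,
    complexHessian_comp (F := fun u => Real.log (baseCoeff a c u)) hu hAev hd,
    ← Nat.cast_succ, complexHessian_const_mul _ hu]
  simp only [hermForm_add, hermForm_smul, baseCoeff, exp_fibrePot hX, gradForm]

/-- With `S = d B + (N + 1) H + c F` and `T = λ H + c F`, where `0 ≤ B ≤ k H`, the quotient `S / T`
lies between two positive constants. -/
theorem quotient_bounds {d k n c lam B H F : ℝ} (hd : 0 ≤ d) (hn : 0 ≤ n) (hc : 0 < c)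
    (hlam : 0 < lam) (hH : 0 ≤ H) (hF : 0 ≤ F) (hB : 0 ≤ B) (hBk : B ≤ k * H)
    (hT : 0 < lam * H + c * F) :
    (d * B + (n + 1) * H + c * F) / (lam * H + c * F) ≤ max ((d * k + (n + 1)) / lam) 1 ∧
      min ((n + 1) / lam) 1 ≤ (d * B + (n + 1) * H + c * F) / (lam * H + c * F) := by
  have hcF : 0 ≤ c * F := by positivity
  constructor
  · rw [div_le_iff₀ hT]
    have h1 : d * B ≤ d * (k * H) := mul_le_mul_of_nonneg_left hBk hd
    have h2 : (d * k + (n + 1)) * H ≤ max ((d * k + (n + 1)) / lam) 1 * (lam * H) := by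
      calc (d * k + (n + 1)) * H = (d * k + (n + 1)) / lam * (lam * H) := by field_simp
        _ ≤ _ := mul_le_mul_of_nonneg_right (le_max_left _ _) (by positivity)
    have h3 : c * F ≤ max ((d * k + (n + 1)) / lam) 1 * (c * F) :=
      le_mul_of_one_le_left hcF (le_max_right _ _)
    linarith
  · rw [le_div_iff₀ hT]
    have h1 : 0 ≤ d * B := mul_nonneg hd hB
    have h2 : min ((n + 1) / lam) 1 * (lam * H) ≤ (n + 1) * H := by
      calc min ((n + 1) / lam) 1 * (lam * H) ≤ (n + 1) / lam * (lam * H) :=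
            mul_le_mul_of_nonneg_right (min_le_left _ _) (by positivity)
        _ = _ := by field_simp
    have h3 : min ((n + 1) / lam) 1 * (c * F) ≤ c * F :=
      mul_le_of_le_one_left hcF (min_le_right _ _)
    linarith

/-- A Hartogs domain over an Einstein base is Ricci pinched for the metric generated by `G_λ`. -/
theorem ricciPinched_hartogsDomain (hB : IsEinsteinBase R h g) (hg : 0 ≤ g) (hN : 1 ≤ N)
    (hK : 0 < K) (hlam : 0 < lam) :
    RicciPinched (hartogsDomain R h N K) (fnG h g K lam) := by
  have hN' : (0 : ℝ) < N := by exact_mod_cast hN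
  have hc : 0 < g + N / K := by positivity
  have ha : 0 < lam / K := by positivity
  have hposdef : ∀ z ∈ hartogsDomain R h N K, (metricMatrix (fnG h g K lam) z).PosDef := by
    intro z hz
    have hpos := hB.pos _ hz.1
    have hX := fnX_lt_one hK hpos hz.2
    have hY := fnY_pos hX
    rw [metricMatrix_fnG hB hK hz, baseCoeff_fibrePot hX]
    exact posDef_adaptedForm (hB.posDef _ hz.1) (baseCoeff_pos ha hc hpos hX)
      (by positivity) (by positivity)
  refine ⟨fun z hz => ⟨?_, ?_, hposdef z hz⟩,
    max ((Fintype.card ι * ((1 + lam / K / (g + N / K)) *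
      (1 + |g + N / K - lam / K| / (g + N / K))) + (N + 1)) / lam) 1,
    min ((N + 1) / lam) 1, lt_max_of_lt_right one_pos, lt_min (by positivity) one_pos,
    fun z hz v hv => ?_⟩
  · have hpos := hB.pos _ hz.1
    have hX := fnX_lt_one hK hpos hz.2
    exact mul_pos (Real.rpow_pos_of_pos (fnY_pos hX) _) (Real.rpow_pos_of_pos hpos _)
  · have hpos := hB.pos _ hz.1
    have hX := fnX_lt_one hK hpos hz.2
    exact ((contDiffAt_const.mul (contDiffAt_fibrePot hpos (hB.smooth _ hz.1) hX)).add
      (contDiffAt_const.mul (contDiffAt_basePot_basePart hpos (hB.smooth _ hz.1)))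
        ).congr_of_eventuallyEq (log_fnG_eventuallyEq hB hK hz)
  have hpos := hB.pos _ hz.1
  have hX := fnX_lt_one hK hpos hz.2
  have hY1 : 1 ≤ fnY h K z := by
    have := mul_nonneg (fnX_nonneg (K := K) hpos) (fnY_pos hX).le
    have := fnX_mul_fnY hX
    linarith
  have hF : 0 ≤ hermForm (formAt h K z 1 0 0) v := by
    rw [formAt, adaptedForm_one_zero_zero, hermForm_liftBase]
    exact hermForm_nonneg (hB.posDef _ hz.1) _
  obtain ⟨hP, hH, hPH⟩ := gradForm_bounds hB hK hz v
  obtain ⟨hlow, hupp⟩ := logAffine_bounds ha hc hY1 hH hP hPH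
  have hT := hermForm_pos (hposdef z hz) hv
  rw [ricciCurvature, hermForm_hessian_log_det hB hc hK hlam hz]
  rw [hermForm_metricMatrix_fnG hB hK hz] at hT ⊢
  obtain ⟨h1, h2⟩ := quotient_bounds (Nat.cast_nonneg (Fintype.card ι)) hN'.le hc hlam hH hF hlow
    hupp hT
  exact ⟨neg_le_neg h1, neg_le_neg h2⟩

end Pinching

end CartanHartogs

end

theorem mainTheorem2 (N : ℕ) (hN : 1 ≤ N) (K lam : ℝ) (hK : 0 < K) (hlam : 0 < lam) :
    (∀ m n : ℕ, 1 ≤ m → 1 ≤ n →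
      CartanHartogs.RicciPinched (CartanHartogs.YI m n N K) (CartanHartogs.GI m n N K lam)) ∧
    (∀ p : ℕ, 1 ≤ p →
      CartanHartogs.RicciPinched (CartanHartogs.YII p N K) (CartanHartogs.GII p N K lam)) ∧
    (∀ q : ℕ, 1 ≤ q →
      CartanHartogs.RicciPinched (CartanHartogs.YIII q N K) (CartanHartogs.GIII q N K lam)) ∧
    (∀ n : ℕ, 1 ≤ n →
      CartanHartogs.RicciPinched (CartanHartogs.YIV n N K) (CartanHartogs.GIV n N K lam)) := by
  refine ⟨fun m n _ _ => ?_, fun p _ => ?_, fun q hq => ?_, fun n _ => ?_⟩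
  · exact CartanHartogs.ricciPinched_hartogsDomain (CartanHartogs.isEinsteinBase_RI m n)
      (by positivity) hN hK hlam
  · exact CartanHartogs.ricciPinched_hartogsDomain (CartanHartogs.isEinsteinBase_RII p)
      (by positivity) hN hK hlam
  · have hq' : (1 : ℝ) ≤ q := by exact_mod_cast hq
    exact CartanHartogs.ricciPinched_hartogsDomain (CartanHartogs.isEinsteinBase_RIII q hq)
      (by linarith) hN hK hlam
  · exact CartanHartogs.ricciPinched_hartogsDomain (CartanHartogs.isEinsteinBase_RIV n)
      (by positivity) hN hK hlam
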